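/- Consider $K$ layers of transmitters and a receiver on the ground. The horizontal positions of the layer-$k$ nodes ($1\le k\le K$) form a homogeneous Poisson point process in the plane with density $\lambda_k>0$; the processes of different layers are independent; all layer-$k$ nodes have altitude $h_k\ge 0$ and transmit with power $P_k>0$. Given all positions, the links to the receiver are independently in environment $\mathrm L$ (line of sight) or $\mathrm N$ (non line of sight); a link of length $x$ from layer $k$ is in $\mathrm L$ with probability $\rho_k^{(\mathrm L)}(x)=\bigl(1+a\exp(-b[\arcsin(h_k/x)-a])\bigr)^{-1}$ and in $\mathrm N$ with probability $\rho_k^{(\mathrm N)}(x)=1-\rho_k^{(\mathrm L)}(x)$, where $a\ge 0$ and $b\in\mathbb R$. Links in environment $c$ have path-loss exponent $\alpha^{(c)}>0$ and channel gains distributed as $\Gamma(m^{(c)},1/m^{(c)})$ (shape, scale), $m^{(c)}>0$; all gains are independent of each other and of the positions and environments. The receiver is associated with the node of largest average received power $P_k x^{-\alpha^{(c)}}$, where $k$, $x$, $c$ are the layer, link length and link environment of the node. Let $I_k^{(c_o)}$ be the sum of the received powers $P_kGx^{-\alpha^{(c_o)}}$ ($G$ the channel gain) over all layer-$k$ nodes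 in environment $c_o$ other than the associated one. Let $j,k$ be layers and $c,c_o\in\{\mathrm L,\mathrm N\}$. For almost every $y$ (with respect to the law of the length of the link to the associated node, conditional on that node being in layer $j$ and environment $c$), the conditional law of $I_k^{(c_o)}$, given that the associated node is in layer $j$ and environment $c$ and has link length $y$, has for all $s\ge 0$ the Laplace transform \[ \exp\left[-2\pi\lambda_k\int_{\max(R,h_k)}^\infty x\,\rho_k^{(c_o)}(x)\left(1-\left(\frac{1}{1+sP_kx^{-\alpha^{(c_o)}}/m^{(c_o)}}\right)^{m^{(c_o)}}\right)dx\right],\qquad R=\left(\frac{P_k\,y^{\alpha^{(c)}}}{P_j}\right)^{1/\alpha^{(c_o)}}, \] where $\exp(-\infty)=0$ if the integral diverges (in which case $I_k^{(c_o)}=\infty$ is allowed). The event that the associated node is in layer $j$ and environment $c$ is measurable, and so are its link length and $I_k^{(c_o)}$. -/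

import Mathlib

open MeasureTheory ProbabilityTheory Set
open scoped ENNReal

noncomputable section

namespace AerialNetwork

/-- The channel environment of a link: line of sight or non line of sight. -/
inductive Env where
  | LoS : Env
  | NLoS : Env
  deriving DecidableEq

instance : MeasurableSpace Env := ⊤

/-- The horizontal plane. -/
abbrev Plane := EuclideanSpace ℝ (Fin 2)

/-- Deterministic parameters of a network with `K` layers of transmitters. -/
structure Params (K : ℕ) where
  /-- environment parameters of the line-of-sight probability -/
  a : ℝ
  b : ℝ
  /-- node density of each layer -/
  dens : Fin K → ℝ
  /-- altitude of each layer -/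
  h : Fin K → ℝ
  /-- transmission power of each layer -/
  P : Fin K → ℝ
  /-- path-loss exponent of each environment -/
  α : Env → ℝ
  /-- Nakagami fading parameter of each environment -/
  m : Env → ℝ
  /-- location of the receiver on the ground -/
  receiver : Plane
  a_nonneg : 0 ≤ a
  dens_pos : ∀ k, 0 < dens k
  h_nonneg : ∀ k, 0 ≤ h k
  P_pos : ∀ k, 0 < P k
  α_pos : ∀ c, 0 < α c
  m_pos : ∀ c, 0 < m c

/-- Probability that a link of length `x` from a layer-`k` node is in environment `c`. -/
def Params.rho {K : ℕ} (par : Params K) (k : Fin K) (c : Env) (x : ℝ) : ℝ :=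
  match c with
  | .LoS => 1 / (1 + par.a * Real.exp (-par.b * (Real.arcsin (par.h k / x) - par.a)))
  | .NLoS => 1 - 1 / (1 + par.a * Real.exp (-par.b * (Real.arcsin (par.h k / x) - par.a)))

/-- Length of the link to the receiver from a layer-`k` node with horizontal position `x`. -/
def Params.linkDist {K : ℕ} (par : Params K) (k : Fin K) (x : Plane) : ℝ :=
  Real.sqrt (‖x - par.receiver‖ ^ 2 + par.h k ^ 2)

/-- The exclusion radius `(P_k y ^ α^{(c)} / P_j) ^ (1 / α^{(c_o)})`. -/
def Params.exclusionRadius {K : ℕ} (par : Params K) (j k : Fin K) (c co : Env) (y : ℝ) : ℝ :=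
  (par.P k * y ^ par.α c / par.P j) ^ (1 / par.α co)

/-- Number of points of the random sequence `X` that lie in `B`. -/
def pointCount {Ω E : Type*} (X : ℕ → Ω → E) (B : Set E) (ω : Ω) : ℝ≥0∞ :=
  ∑' i, B.indicator (fun _ => (1 : ℝ≥0∞)) (X i ω)

/-- The points `X 0, X 1, …` (in any order) form a Poisson point process with intensity
measure `Λ`: counts of sets of finite intensity are Poisson distributed, and counts of
pairwise disjoint sets are independent. -/
structure IsPoissonProcess {Ω E : Type*} [MeasurableSpace Ω] [MeasurableSpace E]
    (X : ℕ → Ω → E) (Λ : Measure E) (μ : Measure Ω) : Prop where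
  measurable : ∀ i, Measurable (X i)
  count_law : ∀ B, MeasurableSet B → Λ B ≠ ∞ →
    HasLaw (pointCount X B)
      ((poissonMeasure (Λ B).toNNReal).map (fun n : ℕ => (n : ℝ≥0∞))) μ
  count_indep : ∀ (n : ℕ) (B : Fin n → Set E), (∀ i, MeasurableSet (B i)) →
    Pairwise (fun i i' => Disjoint (B i) (B i')) →
    iIndepFun (fun i => pointCount X (B i)) μ

/-- A random network. The pair `(k, i)` is the `i`-th node of layer `k`, `pos (k, i)` its
horizontal position, `env (k, i)` the environment of its link to the receiver and
`gain c (k, i)` the channel gain of that link if it is in environment `c`. -/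
structure Network {K : ℕ} (par : Params K) {Ω : Type*} [MeasurableSpace Ω]
    (μ : Measure Ω) where
  pos : Fin K × ℕ → Ω → Plane
  env : Fin K × ℕ → Ω → Env
  gain : Env → Fin K × ℕ → Ω → ℝ
  /-- each layer is a homogeneous Poisson point process -/
  poisson : ∀ k, IsPoissonProcess (fun i => pos (k, i))
    (ENNReal.ofReal (par.dens k) • (volume : Measure Plane)) μ
  /-- the layers are independent -/
  layers_indep : iIndepFun (fun (k : Fin K) (ω : Ω) (i : ℕ) => pos (k, i) ω) μ
  env_measurable : ∀ p, Measurable (env p)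
  /-- given all positions, the environments of the links are independent, and a link of
  length `x` from layer `k` is in environment `c` with probability `ρ_k^{(c)}(x)` -/
  env_law : ∀ (S : Finset (Fin K × ℕ)) (e : Fin K × ℕ → Env),
    μ⟦⋂ p ∈ S, {ω | env p ω = e p} |
        MeasurableSpace.comap (fun (ω : Ω) (p : Fin K × ℕ) => pos p ω) inferInstance⟧
      =ᵐ[μ] fun ω => ∏ p ∈ S, par.rho p.1 (e p) (par.linkDist p.1 (pos p ω))
  gain_measurable : ∀ c p, Measurable (gain c p)
  /-- Nakagami fading: Gamma distributed gains with shape `m` and scale `1 / m` -/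
  gain_law : ∀ c p, HasLaw (gain c p) (gammaMeasure (par.m c) (par.m c)) μ
  gain_indep : iIndepFun (fun (q : Env × (Fin K × ℕ)) => gain q.1 q.2) μ
  gain_indep_geometry : IndepFun
    (fun (ω : Ω) (q : Env × (Fin K × ℕ)) => gain q.1 q.2 ω)
    (fun (ω : Ω) => ((fun p => pos p ω, fun p => env p ω) :
      (Fin K × ℕ → Plane) × (Fin K × ℕ → Env))) μ

namespace Network

variable {K : ℕ} {par : Params K} {Ω : Type*} [MeasurableSpace Ω] {μ : Measure Ω}

/-- Length of the link from node `p` to the receiver. -/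
def dist (net : Network par μ) (p : Fin K × ℕ) (ω : Ω) : ℝ :=
  par.linkDist p.1 (net.pos p ω)

/-- Average received power from node `p`. -/
def avgPower (net : Network par μ) (p : Fin K × ℕ) (ω : Ω) : ℝ :=
  par.P p.1 * net.dist p ω ^ (-par.α (net.env p ω))

open Classical in
/-- The associated transmitter: the node with the strongest average received power (the
first such node in case of ties, `none` if there is no such node). -/
def mainNode (net : Network par μ) (ω : Ω) : Option (Fin K × ℕ) :=
  if H : ∃ p, ∀ q, net.avgPower q ω ≤ net.avgPower p ω then some (Encodable.choose H) else none

/-- The event that the associated transmitter is in layer `j` and environment `c`. -/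
def assocEvent (net : Network par μ) (j : Fin K) (c : Env) : Set Ω :=
  {ω | ∃ i, net.mainNode ω = some (j, i) ∧ net.env (j, i) ω = c}

/-- The length of the main link (`0` if there is no associated transmitter). -/
def mainDist (net : Network par μ) (ω : Ω) : ℝ :=
  match net.mainNode ω with
  | some p => net.dist p ω
  | none => 0

open Classical in
/-- The total power received from the layer-`k` nodes in environment `c` other than the
associated transmitter. -/
def interference (net : Network par μ) (k : Fin K) (c : Env) (ω : Ω) : ℝ≥0∞ :=
  ∑' i, if net.env (k, i) ω = c ∧ net.mainNode ω ≠ some (k, i) then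
    ENNReal.ofReal (par.P k * net.gain c (k, i) ω * net.dist (k, i) ω ^ (-par.α c)) else 0

end Network

/-- `exp (-t)` for `t ∈ [0, ∞]`, with `exp (-∞) = 0`. -/
def expNeg (t : ℝ≥0∞) : ℝ≥0∞ := EReal.exp (-(t : EReal))

/-- The Laplace transform at `s ≥ 0` of a measure on `[0, ∞]`. -/
def laplace (ν : Measure ℝ≥0∞) (s : ℝ) : ℝ≥0∞ :=
  ∫⁻ t, expNeg (ENNReal.ofReal s * t) ∂ν

end AerialNetwork

end

/-! Give every node the mark (layer, position, environment, gain). Independent marking and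
superposition of the layers make the marked nodes a Poisson process with intensity `M =
markIntensity`, in the sense that `E exp(-∑ f) = exp(-∫ (1 - exp(-f)) dM)` for every measurable `f ≥
0` (`hasPoissonLaplace_mark`). Everything about the marked process is deduced from this Laplace
functional alone.

Differentiating it in the direction `h` gives Campbell's formula, and removing the factor of the
point itself gives the reduced Mecke formula: a typical point sees the others as a full copy of the
process. An infinite weight on the points of average power above `t` encodes the event that the
maximum is at most `t` (`capAt`). Hence a point and the maximal level of the others are governed by
a product measure (`pointMaxLaw_eq_prod`). As level sets are `M`-null there are almost surely no
ties, so the associated node is the point that dominates the others, and `lintegral_tsum_max`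
computes expectations over it.

The resulting exponent splits. Nodes stronger than the associated one give a void probability free
of `s`; the weaker ones give the claimed radial integral, which depends on the associated node only
through its layer, environment and link length (`lintegral_one_sub_expNeg_capAt`). Thus on the
association event the weight `exp(-s I)` may be replaced by the claimed transform at the main link
length, inside any integral against a function of that length. This identifies the conditional
transform for almost every `y` at fixed `s`; rational `s` and a limit give one null set for all `s`.
-/

noncomputable section

namespace AerialNetwork

/-! ### The function `exp(-t)` on `[0, ∞]` and its difference quotients at zero. -/

section ExpNeg

@[simp] lemma expNeg_zero : expNeg 0 = 1 := by simp [expNeg]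

@[simp] lemma expNeg_top : expNeg ∞ = 0 := by simp [expNeg]

lemma expNeg_ofReal {x : ℝ} (hx : 0 ≤ x) :
    expNeg (ENNReal.ofReal x) = ENNReal.ofReal (Real.exp (-x)) := by
  rw [expNeg, EReal.coe_ennreal_ofReal, max_eq_left hx, ← EReal.coe_neg, EReal.exp_coe]

lemma expNeg_add (x y : ℝ≥0∞) : expNeg (x + y) = expNeg x * expNeg y := by
  rw [expNeg, EReal.coe_ennreal_add, EReal.neg_add, sub_eq_add_neg, EReal.exp_add]
  · rfl
  · left; simp
  · right; simp

lemma expNeg_antitone : Antitone expNeg := fun _ _ h =>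
  EReal.exp_monotone (EReal.neg_le_neg_iff.2 (EReal.coe_ennreal_le_coe_ennreal_iff.2 h))

lemma expNeg_le_one (x : ℝ≥0∞) : expNeg x ≤ 1 :=
  (expNeg_antitone zero_le).trans expNeg_zero.le

lemma expNeg_ne_top (x : ℝ≥0∞) : expNeg x ≠ ∞ :=
  ((expNeg_le_one x).trans_lt ENNReal.one_lt_top).ne

lemma expNeg_ne_zero {x : ℝ≥0∞} (hx : x ≠ ∞) : expNeg x ≠ 0 := by
  rw [expNeg, Ne, EReal.exp_eq_zero_iff, EReal.neg_eq_bot_iff]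
  simpa using hx

lemma continuous_expNeg : Continuous expNeg :=
  ENNReal.continuous_exp.comp (continuous_neg.comp continuous_coe_ennreal_ereal)

@[fun_prop]
lemma measurable_expNeg : Measurable expNeg := continuous_expNeg.measurable

lemma expNeg_sum {ι : Type*} (s : Finset ι) (f : ι → ℝ≥0∞) :
    expNeg (∑ i ∈ s, f i) = ∏ i ∈ s, expNeg (f i) := by
  classical
  induction s using Finset.induction_on with
  | empty => simp
  | insert a s ha ih => rw [Finset.sum_insert ha, Finset.prod_insert ha, expNeg_add, ih]

lemma expNeg_nat_mul (x : ℝ≥0∞) (n : ℕ) : expNeg (x * n) = expNeg x ^ n := by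
  induction n with
  | zero => simp
  | succ n ih => rw [Nat.cast_succ, mul_add, mul_one, expNeg_add, ih, pow_succ]

lemma expNeg_iSup {ι : Sort*} [Nonempty ι] (x : ι → ℝ≥0∞) :
    expNeg (⨆ i, x i) = ⨅ i, expNeg (x i) :=
  expNeg_antitone.map_ciSup_of_continuousAt continuous_expNeg.continuousAt

lemma one_sub_expNeg_iSup {ι : Sort*} [Nonempty ι] (x : ι → ℝ≥0∞) :
    1 - expNeg (⨆ i, x i) = ⨆ i, (1 - expNeg (x i)) := by
  rw [expNeg_iSup, ENNReal.sub_iInf]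

lemma one_sub_expNeg_mono : Monotone fun x => 1 - expNeg x := fun _ _ h =>
  tsub_le_tsub_left (expNeg_antitone h) 1

/-- Every number in `[0, 1]` is of the form `exp (-x)`. -/
def negLog (w : ℝ≥0∞) : ℝ≥0∞ := (-(ENNReal.log w)).toENNReal

@[fun_prop]
lemma measurable_negLog : Measurable negLog := by
  unfold negLog
  fun_prop

lemma expNeg_negLog {w : ℝ≥0∞} (hw : w ≤ 1) : expNeg (negLog w) = w := by
  have : 0 ≤ -(ENNReal.log w) := by
    rw [EReal.neg_nonneg]
    exact ENNReal.log_le_zero_iff.2 hw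
  rw [expNeg, negLog, EReal.coe_toENNReal this, neg_neg, ENNReal.exp_log]

lemma one_sub_expNeg_add (x y : ℝ≥0∞) :
    1 - expNeg (x + y) = (1 - expNeg x) + expNeg x * (1 - expNeg y) := by
  have hx := expNeg_le_one x
  rw [expNeg_add, ENNReal.mul_sub (fun _ _ => expNeg_ne_top x), mul_one]
  exact (tsub_add_tsub_cancel hx (mul_le_of_le_one_right zero_le (expNeg_le_one y))).symm

/-- These are the chord slopes at `0` of the concave function `t ↦ 1 - exp(-x t)`, taken at `t = 1 /
(n + 1)`; they grow as the chord shrinks. -/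
lemma one_sub_exp_mul_mono (x : ℝ) :
    Monotone fun n : ℕ => (n + 1 : ℝ) * (1 - Real.exp (-(x / (n + 1)))) := by
  intro m n hmn
  have hm : (0 : ℝ) < m + 1 := by positivity
  have hn : (0 : ℝ) < n + 1 := by positivity
  have hmn' : (m : ℝ) + 1 ≤ n + 1 := by exact_mod_cast Nat.succ_le_succ hmn
  set t : ℝ := (m + 1) / (n + 1) with ht
  have ht0 : 0 < t := by positivity
  have ht1 : t ≤ 1 := (div_le_one hn).2 hmn'
  have key : Real.exp (t * (-(x / (m + 1))) + (1 - t) * 0) ≤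
      t * Real.exp (-(x / (m + 1))) + (1 - t) * Real.exp 0 :=
    convexOn_exp.2 (mem_univ _) (mem_univ _) ht0.le (by linarith) (by ring)
  have e1 : t * (-(x / (m + 1))) + (1 - t) * 0 = -(x / (n + 1)) := by
    rw [ht]; field_simp; ring
  rw [e1, Real.exp_zero] at key
  have e2 : (n + 1 : ℝ) * t = m + 1 := by rw [ht]; field_simp
  dsimp only
  have e3 : (n + 1 : ℝ) * (t * Real.exp (-(x / (m + 1))) + (1 - t) * 1) =
      (m + 1) * Real.exp (-(x / (m + 1))) + (n + 1) - (m + 1) := by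
    rw [← e2]; ring
  have := mul_le_mul_of_nonneg_left key hn.le
  rw [e3] at this
  linarith

lemma mul_one_sub_expNeg_div {x : ℝ≥0∞} (hx : x ≠ ∞) (n : ℕ) :
    ((n + 1 : ℕ) : ℝ≥0∞) * (1 - expNeg (x / (n + 1 : ℕ))) =
      ENNReal.ofReal ((n + 1 : ℝ) * (1 - Real.exp (-(x.toReal / (n + 1))))) := by
  have hn : (0 : ℝ) < n + 1 := by positivity
  rw [ENNReal.ofReal_mul hn.le, ENNReal.ofReal_sub _ (Real.exp_pos _).le,
    ← expNeg_ofReal (by positivity), ENNReal.ofReal_div_of_pos hn, ENNReal.ofReal_toReal hx,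
    ENNReal.ofReal_one]
  have : ENNReal.ofReal ((n : ℝ) + 1) = ((n + 1 : ℕ) : ℝ≥0∞) := by
    rw [← ENNReal.ofReal_natCast]; push_cast; rfl
  rw [this]

lemma expNeg_div_nat_mono (x : ℝ≥0∞) :
    Monotone fun n : ℕ => ((n + 1 : ℕ) : ℝ≥0∞) * (1 - expNeg (x / (n + 1 : ℕ))) := by
  intro m n hmn
  rcases eq_or_ne x ∞ with rfl | hx
  · have : ∀ n : ℕ, (∞ : ℝ≥0∞) / (n + 1 : ℕ) = ∞ := fun n =>
      ENNReal.top_div_of_ne_top (by finiteness)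
    simp only [this, expNeg_top, tsub_zero, mul_one]
    exact_mod_cast Nat.succ_le_succ hmn
  · simp only [mul_one_sub_expNeg_div hx]
    exact ENNReal.ofReal_le_ofReal (one_sub_exp_mul_mono _ hmn)

/-- The derivative of `1 - exp(-t x)` at `t = 0`, written as an increasing limit. Monotone
convergence then differentiates Laplace functionals without any integrability condition. -/
lemma iSup_expNeg_div_nat (x : ℝ≥0∞) :
    ⨆ n : ℕ, ((n + 1 : ℕ) : ℝ≥0∞) * (1 - expNeg (x / (n + 1 : ℕ))) = x := by
  rcases eq_or_ne x ∞ with rfl | hx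
  · have : ∀ n : ℕ, (∞ : ℝ≥0∞) / (n + 1 : ℕ) = ∞ := fun n =>
      ENNReal.top_div_of_ne_top (by finiteness)
    simp only [this, expNeg_top, tsub_zero, mul_one]
    rw [eq_top_iff, ← ENNReal.iSup_natCast]
    exact iSup_mono fun n => by exact_mod_cast Nat.le_succ n
  · refine iSup_eq_of_tendsto (expNeg_div_nat_mono x) ?_
    simp only [mul_one_sub_expNeg_div hx]
    conv => enter [3]; rw [← ENNReal.ofReal_toReal hx]
    refine ENNReal.tendsto_ofReal ?_
    set y := x.toReal
    have hd : HasDerivAt (fun t : ℝ => 1 - Real.exp (-(y * t))) y 0 := by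
      have h1 : HasDerivAt (fun t : ℝ => -(y * t)) (-y) 0 := by
        simpa using ((hasDerivAt_id (0 : ℝ)).const_mul y).fun_neg
      simpa using (h1.exp).const_sub 1
    have ht : Filter.Tendsto (fun n : ℕ => (1 : ℝ) / (n + 1)) Filter.atTop
        (nhdsWithin 0 (Ioi 0)) := by
      refine tendsto_nhdsWithin_iff.2 ⟨tendsto_one_div_add_atTop_nhds_zero_nat, ?_⟩
      exact Filter.Eventually.of_forall fun n => by simp only [mem_Ioi]; positivity
    refine (hd.tendsto_slope_zero_right.comp ht).congr fun n => ?_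
    simp [div_eq_mul_inv]

/-- The diagonal version of `iSup_expNeg_div_nat`. -/
lemma iSup_mul_one_sub_expNeg {x : ℕ → ℝ≥0∞}
    (hx : Monotone fun n => ((n + 1 : ℕ) : ℝ≥0∞) * x n) :
    ⨆ n : ℕ, ((n + 1 : ℕ) : ℝ≥0∞) * (1 - expNeg (x n)) =
      ⨆ n : ℕ, ((n + 1 : ℕ) : ℝ≥0∞) * x n := by
  set y : ℕ → ℝ≥0∞ := fun n => ((n + 1 : ℕ) : ℝ≥0∞) * x n with hy
  have hxy : ∀ n, x n = y n / (n + 1 : ℕ) := fun n => by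
    rw [hy]
    dsimp only
    rw [mul_comm, ENNReal.mul_div_cancel_right (by simp) (by finiteness)]
  apply le_antisymm
  · refine iSup_le fun n => ?_
    rw [hxy n]
    refine le_trans ?_ (le_iSup y n)
    conv_rhs => rw [← iSup_expNeg_div_nat (y n)]
    exact le_iSup (fun k : ℕ => ((k + 1 : ℕ) : ℝ≥0∞) * (1 - expNeg (y n / (k + 1 : ℕ)))) n
  -- For fixed `m` the quotients of the constant `y m` have supremum `y m`, and the one at index
  -- `max m n` is at most the diagonal term because `y m ≤ y (max m n)`.
  · refine iSup_le fun m => ?_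
    change y m ≤ _
    rw [← iSup_expNeg_div_nat (y m)]
    refine iSup_le fun n => ?_
    refine le_trans ?_ (le_iSup _ (max m n))
    refine (expNeg_div_nat_mono (y m) (le_max_right m n)).trans ?_
    dsimp only
    rw [hxy (max m n)]
    gcongr 1
    refine one_sub_expNeg_mono ?_
    gcongr
    exact hx (le_max_left m n)

end ExpNeg

/-! ### The Laplace functional of a Poisson process. -/

section Poisson

lemma lintegral_expNeg_mul_poissonMeasure (a : ℝ≥0∞) (r : NNReal) :
    ∫⁻ n : ℕ, expNeg (a * n) ∂poissonMeasure r = expNeg (r * (1 - expNeg a)) := by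
  have hq : expNeg a = ENNReal.ofReal (expNeg a).toReal :=
    (ENNReal.ofReal_toReal (expNeg_ne_top a)).symm
  set q := (expNeg a).toReal
  have hq0 : 0 ≤ q := ENNReal.toReal_nonneg
  have hq1 : q ≤ 1 := by
    have := expNeg_le_one a
    rw [hq] at this
    simpa using this
  rw [lintegral_countable']
  have hterm : ∀ n : ℕ, expNeg (a * n) * poissonMeasure r {n} =
      ENNReal.ofReal (Real.exp (-r) * ((r * q) ^ n / (n.factorial : ℝ))) := by
    intro n
    rw [expNeg_nat_mul, hq, poissonMeasure_singleton, ← ENNReal.ofReal_pow hq0,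
      ← ENNReal.ofReal_mul (by positivity)]
    congr 1
    rw [mul_pow]
    ring
  simp only [hterm]
  have hs : HasSum (fun n : ℕ => Real.exp (-r) * ((r * q) ^ n / (n.factorial : ℝ)))
      (Real.exp (-r) * Real.exp (r * q)) := by
    have := NormedSpace.expSeries_div_hasSum_exp (r * q : ℝ)
    rw [← Real.exp_eq_exp_ℝ] at this
    exact this.mul_left _
  rw [← ENNReal.ofReal_tsum_of_nonneg (fun n => by positivity) hs.summable, hs.tsum_eq, hq,
    ← ENNReal.ofReal_one, ← ENNReal.ofReal_sub _ hq0, ← ENNReal.ofReal_coe_nnreal,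
    ← ENNReal.ofReal_mul (by positivity), expNeg_ofReal (by
      have : 0 ≤ 1 - q := by linarith
      positivity), ← Real.exp_add]
  ring_nf

variable {Ω E : Type*} [MeasurableSpace Ω] [MeasurableSpace E] {μ : Measure Ω}
  {X : ℕ → Ω → E} {Λ : Measure E}

lemma IsPoissonProcess.measurable_pointCount (hX : IsPoissonProcess X Λ μ) {B : Set E}
    (hB : MeasurableSet B) : Measurable (pointCount X B) :=
  Measurable.tsum fun i => (measurable_const.indicator hB).comp (hX.measurable i)

lemma IsPoissonProcess.lintegral_expNeg_pointCount (hX : IsPoissonProcess X Λ μ) {B : Set E}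
    (hB : MeasurableSet B) (hB' : Λ B ≠ ∞) (a : ℝ≥0∞) :
    ∫⁻ ω, expNeg (a * pointCount X B ω) ∂μ = expNeg (Λ B * (1 - expNeg a)) := by
  have hm : Measurable fun t : ℝ≥0∞ => expNeg (a * t) := by fun_prop
  rw [← lintegral_map hm (hX.measurable_pointCount hB), (hX.count_law B hB hB').map_eq,
    lintegral_map hm measurable_from_top, lintegral_expNeg_mul_poissonMeasure,
    ENNReal.coe_toNNReal hB']

/-- The Laplace functional of a Poisson process at a simple function. -/
lemma IsPoissonProcess.laplace_simpleFunc (hX : IsPoissonProcess X Λ μ) (φ : SimpleFunc E ℝ≥0∞)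
    (hφ : ∀ a, a ≠ 0 → Λ (φ ⁻¹' {a}) ≠ ∞) :
    ∫⁻ ω, expNeg (∑' i, φ (X i ω)) ∂μ = expNeg (∫⁻ x, (1 - expNeg (φ x)) ∂Λ) := by
  classical
  set s : Finset ℝ≥0∞ := φ.range.filter (· ≠ 0) with hs
  have hs0 : ∀ a ∈ s, a ≠ 0 := fun a ha => (Finset.mem_filter.1 ha).2
  have hsum : ∀ ω, ∑' i, φ (X i ω) = ∑ a ∈ s, a * pointCount X (φ ⁻¹' {a}) ω := by
    intro ω
    have : ∀ x, φ x = ∑ a ∈ s, a * (φ ⁻¹' {a}).indicator (fun _ => (1 : ℝ≥0∞)) x := by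
      intro x
      by_cases hx : φ x = 0
      · rw [hx, Finset.sum_eq_zero]
        intro a ha
        have : x ∉ φ ⁻¹' {a} := fun h => hs0 a ha (by rw [← hx]; exact h.symm)
        rw [indicator_of_notMem this, mul_zero]
      · rw [Finset.sum_eq_single (φ x)]
        · simp
        · intro b _ hb
          have : x ∉ φ ⁻¹' {b} := fun h => hb h.symm
          rw [indicator_of_notMem this, mul_zero]
        · intro h
          exact absurd (Finset.mem_filter.2 ⟨φ.mem_range_self x, hx⟩) h
    calc ∑' i, φ (X i ω) = ∑' i, ∑ a ∈ s, a * (φ ⁻¹' {a}).indicator (fun _ => (1 : ℝ≥0∞)) (X i ω) :=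
          tsum_congr fun i => this _
      _ = ∑ a ∈ s, ∑' i, a * (φ ⁻¹' {a}).indicator (fun _ => (1 : ℝ≥0∞)) (X i ω) :=
          Summable.tsum_finsetSum fun _ _ => ENNReal.summable
      _ = _ := Finset.sum_congr rfl fun a _ => ENNReal.tsum_mul_left
  simp only [hsum, expNeg_sum]
  set e := s.equivFin
  have hprod : ∀ g : ℝ≥0∞ → ℝ≥0∞, ∏ a ∈ s, g a = ∏ i : Fin s.card, g (e.symm i) := by
    intro g
    rw [← Finset.prod_coe_sort s g]
    exact Fintype.prod_equiv e _ _ fun x => by simp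
  -- Distinct level sets of `φ` are disjoint, so the expectation factors into Poisson generating
  -- functions.
  have hindep := hX.count_indep s.card (fun i => φ ⁻¹' {(e.symm i : ℝ≥0∞)})
    (fun i => φ.measurableSet_preimage _) (by
      intro i i' hii
      refine Disjoint.preimage _ (disjoint_singleton.2 fun h => hii ?_)
      exact e.symm.injective (Subtype.ext h))
  have hindep' := hindep.comp (fun i t => expNeg ((e.symm i : ℝ≥0∞) * t)) (fun i => by fun_prop)
  simp only [hprod]
  have h1 := lintegral_prod_eq_prod_lintegral_of_indepFun Finset.univ _ hindep' (fun i =>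
    (by fun_prop : Measurable fun t : ℝ≥0∞ => expNeg ((e.symm i : ℝ≥0∞) * t)).comp
      (hX.measurable_pointCount (φ.measurableSet_preimage _)))
  simp only [Function.comp_apply] at h1
  rw [h1, ← hprod (fun a => ∫⁻ ω, expNeg (a * pointCount X (φ ⁻¹' {a}) ω) ∂μ)]
  have h2 : ∫⁻ x, (1 - expNeg (φ x)) ∂Λ = ∑ a ∈ s, Λ (φ ⁻¹' {a}) * (1 - expNeg a) := by
    have := (φ.map fun a => 1 - expNeg a).lintegral_eq_lintegral Λ
    simp only [SimpleFunc.coe_map, Function.comp_apply] at this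
    rw [this, SimpleFunc.map_lintegral, hs, Finset.sum_filter]
    refine Finset.sum_congr rfl fun a _ => ?_
    split_ifs with h
    · rw [mul_comm]
    · rw [not_not.1 h]
      simp
  rw [h2, expNeg_sum]
  exact Finset.prod_congr rfl fun a ha => hX.lintegral_expNeg_pointCount
    (φ.measurableSet_preimage _) (hφ a (hs0 a ha)) a

/-- Monotone convergence for the counting measure. -/
lemma tsum_iSup_of_monotone {ι : Type*} {f : ℕ → ι → ℝ≥0∞} (hf : Monotone f) :
    ∑' i, ⨆ n, f n i = ⨆ n, ∑' i, f n i := by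
  let _ : MeasurableSpace ι := ⊤
  have := lintegral_iSup (μ := Measure.count) (f := f) (fun n => measurable_from_top) hf
  simpa only [lintegral_count] using this

/-- Functions `f` at which the Laplace functional of a Poisson process has the expected form are
closed under increasing limits. -/
lemma laplace_iSup {ι : Type*} [Countable ι] [IsProbabilityMeasure μ] {Y : ι → Ω → E}
    (hY : ∀ i, Measurable (Y i)) {f : ℕ → E → ℝ≥0∞} (hf : ∀ n, Measurable (f n))
    (hmono : Monotone f)
    (h : ∀ n, ∫⁻ ω, expNeg (∑' i, f n (Y i ω)) ∂μ = expNeg (∫⁻ x, (1 - expNeg (f n x)) ∂Λ)) :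
    ∫⁻ ω, expNeg (∑' i, ⨆ n, f n (Y i ω)) ∂μ =
      expNeg (∫⁻ x, (1 - expNeg (⨆ n, f n x)) ∂Λ) := by
  have h1 : ∀ ω, expNeg (∑' i, ⨆ n, f n (Y i ω)) = ⨅ n, expNeg (∑' i, f n (Y i ω)) := by
    intro ω
    rw [tsum_iSup_of_monotone (f := fun n i => f n (Y i ω)) fun m n hmn i => hmono hmn _,
      expNeg_iSup]
  simp only [h1]
  rw [lintegral_iInf, iInf_congr h, ← expNeg_iSup, ← lintegral_iSup]
  · simp only [one_sub_expNeg_iSup]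
  · exact fun n => measurable_const.sub (measurable_expNeg.comp (hf n))
  · exact fun m n hmn x => one_sub_expNeg_mono (hmono hmn x)
  · exact fun n => measurable_expNeg.comp (Measurable.tsum fun i => (hf n).comp (hY i))
  · exact fun m n hmn ω => expNeg_antitone (ENNReal.tsum_le_tsum fun i => hmono hmn _)
  · exact (((lintegral_mono fun ω => expNeg_le_one _).trans (by simp)).trans_lt
      ENNReal.one_lt_top).ne

/-- The Laplace functional of a Poisson process. -/
lemma IsPoissonProcess.laplace_functional [IsProbabilityMeasure μ] [SigmaFinite Λ]
    (hX : IsPoissonProcess X Λ μ) {f : E → ℝ≥0∞} (hf : Measurable f) :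
    ∫⁻ ω, expNeg (∑' i, f (X i ω)) ∂μ = expNeg (∫⁻ x, (1 - expNeg (f x)) ∂Λ) := by
  -- The restriction to sets of finite intensity gives every nonzero level set finite intensity, as
  -- the case of simple functions requires.
  set φ : ℕ → SimpleFunc E ℝ≥0∞ := fun n =>
    (SimpleFunc.eapprox f n).restrict (spanningSets Λ n) with hφ
  have hval : ∀ n x, φ n x = (spanningSets Λ n).indicator (SimpleFunc.eapprox f n) x := fun n x =>
    SimpleFunc.restrict_apply _ (measurableSet_spanningSets Λ n) _
  have hmono : Monotone fun n => (φ n : E → ℝ≥0∞) := by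
    intro m n hmn x
    simp only [hval]
    refine (indicator_le_indicator_of_subset (monotone_spanningSets Λ hmn)
      (fun _ => zero_le) x).trans ?_
    exact indicator_le_indicator (SimpleFunc.monotone_eapprox f hmn x)
  have hsup : ∀ x, ⨆ n, φ n x = f x := by
    intro x
    apply le_antisymm
    · refine iSup_le fun n => ?_
      rw [hval, ← SimpleFunc.iSup_eapprox_apply hf x]
      exact (indicator_le_self' (fun _ _ => zero_le) x).trans
        (le_iSup (fun n => SimpleFunc.eapprox f n x) n)
    · rw [← SimpleFunc.iSup_eapprox_apply hf x]
      refine iSup_le fun n => ?_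
      obtain ⟨k, hk⟩ := mem_iUnion.1 (show x ∈ ⋃ k, spanningSets Λ k by
        rw [iUnion_spanningSets]; trivial)
      refine le_trans ?_ (le_iSup _ (max k n))
      rw [hval, indicator_of_mem (monotone_spanningSets Λ (le_max_left k n) hk)]
      exact SimpleFunc.monotone_eapprox f (le_max_right k n) x
  have := laplace_iSup (μ := μ) (Λ := Λ) hX.measurable (fun n => (φ n).measurable) hmono (fun n => by
    refine hX.laplace_simpleFunc (φ n) fun a ha => ?_
    refine ((measure_mono ?_).trans_lt (measure_spanningSets_lt_top Λ n)).ne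
    intro x hx
    by_contra hxn
    apply ha
    rw [← (hx : φ n x = a), hval, indicator_of_notMem hxn])
  simpa only [hsup] using this

end Poisson

/-! ### Mecke formulas and the maximal point, from the Laplace functional. -/

section Palm

/-- The points `Y i` have the Laplace functional of a Poisson process with intensity `M`. -/
structure HasPoissonLaplace {Ω E ι : Type*} [MeasurableSpace Ω] [MeasurableSpace E]
    (Y : ι → Ω → E) (M : Measure E) (μ : Measure Ω) : Prop where
  measurable : ∀ i, Measurable (Y i)
  laplace : ∀ f : E → ℝ≥0∞, Measurable f →
    ∫⁻ ω, expNeg (∑' i, f (Y i ω)) ∂μ = expNeg (∫⁻ x, (1 - expNeg (f x)) ∂M)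

namespace HasPoissonLaplace

variable {Ω E ι : Type*} {Y : ι → Ω → E}

/-- The sum of `f` over the points other than the `i`-th. -/
def othersSum (Y : ι → Ω → E) (f : E → ℝ≥0∞) (i : ι) (ω : Ω) : ℝ≥0∞ :=
  ∑' q : {q // q ≠ i}, f (Y q ω)

/-- The supremum of `z` over the points other than the `i`-th. -/
def othersSup (Y : ι → Ω → E) (z : E → ℝ≥0∞) (i : ι) (ω : Ω) : ℝ≥0∞ :=
  ⨆ q : {q // q ≠ i}, z (Y q ω)

lemma tsum_eq_add_othersSum (Y : ι → Ω → E) (f : E → ℝ≥0∞) (i : ι) (ω : Ω) :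
    ∑' q, f (Y q ω) = f (Y i ω) + othersSum Y f i ω := by
  classical
  have := (ENNReal.summable (f := fun q : ({i} : Set ι) => f (Y q ω))).tsum_add_tsum_compl
    (f := fun q => f (Y q ω)) (s := {i}) ENNReal.summable
  rw [← this, tsum_fintype]
  simp [othersSum]
  rfl

/-- Adds an infinite weight to the points at level above `t`. -/
def capAt (F z : E → ℝ≥0∞) (t : ℝ≥0∞) (x : E) : ℝ≥0∞ :=
  F x + {y | t < z y}.indicator (fun _ => ∞) x

/-- One point above level `t` makes the sum infinite and the exponential zero, so the cap acts as
the indicator that the supremum is at most `t`. -/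
lemma expNeg_tsum_capAt {κ : Type*} (F z : E → ℝ≥0∞) (t : ℝ≥0∞) (x : κ → E) :
    expNeg (∑' i, capAt F z t (x i)) =
      (Iic t).indicator (fun _ => expNeg (∑' i, F (x i))) (⨆ i, z (x i)) := by
  by_cases h : ⨆ i, z (x i) ≤ t
  · rw [indicator_of_mem (mem_Iic.2 h)]
    congr 1
    refine tsum_congr fun i => ?_
    have : x i ∉ {y | t < z y} := not_lt.2 ((le_iSup (fun i => z (x i)) i).trans h)
    rw [capAt, indicator_of_notMem this, add_zero]
  · rw [indicator_of_notMem (fun h' => h (mem_Iic.1 h'))]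
    obtain ⟨i, hi⟩ := lt_iSup_iff.1 (not_le.1 h)
    have : capAt F z t (x i) = ∞ := by
      rw [capAt, indicator_of_mem (show x i ∈ {y | t < z y} from hi), add_top]
    rw [ENNReal.tsum_eq_top_of_eq_top ⟨i, this⟩, expNeg_top]

lemma expNeg_othersSum_capAt (Y : ι → Ω → E) (F z : E → ℝ≥0∞) (t : ℝ≥0∞) (i : ι) (ω : Ω) :
    expNeg (othersSum Y (capAt F z t) i ω) =
      (Iic t).indicator (fun _ => expNeg (othersSum Y F i ω)) (othersSup Y z i ω) :=
  expNeg_tsum_capAt F z t fun q : {q // q ≠ i} => Y q ω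

variable [MeasurableSpace Ω] [MeasurableSpace E] {M : Measure E} {μ : Measure Ω}

lemma measurable_comp (hY : HasPoissonLaplace Y M μ) {f : E → ℝ≥0∞} (hf : Measurable f) (i : ι) :
    Measurable fun ω => f (Y i ω) := hf.comp (hY.measurable i)

lemma measurable_tsum [Countable ι] (hY : HasPoissonLaplace Y M μ) {f : E → ℝ≥0∞} (hf : Measurable f) :
    Measurable fun ω => ∑' i, f (Y i ω) :=
  Measurable.tsum fun i => hY.measurable_comp hf i

/-- Campbell's formula with an exponential weight, the derivative of the Laplace functional. -/
lemma lintegral_tsum_mul_expNeg [Countable ι] [IsProbabilityMeasure μ] (hY : HasPoissonLaplace Y M μ)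
    {f h : E → ℝ≥0∞} (hf : Measurable f) (hh : Measurable h) :
    ∫⁻ ω, (∑' i, h (Y i ω)) * expNeg (∑' i, f (Y i ω)) ∂μ =
      (∫⁻ x, h x * expNeg (f x) ∂M) * expNeg (∫⁻ x, (1 - expNeg (f x)) ∂M) := by
  have hfm := hY.measurable_tsum hf
  have hhm := hY.measurable_tsum hh
  set I := ∫⁻ x, (1 - expNeg (f x)) ∂M
  -- The increment of the Laplace exponent from `f` to `f + h / (n + 1)`. Multiplied by `n + 1` it
  -- increases to `∫ h exp(-f) dM`; since `D n` varies with `n`, the diagonal limit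
  -- `iSup_mul_one_sub_expNeg` is needed.
  set D : ℕ → ℝ≥0∞ := fun n => ∫⁻ x, expNeg (f x) * (1 - expNeg (h x / (n + 1 : ℕ))) ∂M with hD
  have hdiff : ∀ n : ℕ,
      ∫⁻ ω, expNeg (∑' i, f (Y i ω)) * (1 - expNeg ((∑' i, h (Y i ω)) / (n + 1 : ℕ))) ∂μ =
        expNeg I * (1 - expNeg (D n)) := by
    intro n
    have hg : Measurable fun x => f x + h x / (n + 1 : ℕ) := by fun_prop
    have hsplit : ∀ ω, expNeg (∑' i, f (Y i ω)) *
        (1 - expNeg ((∑' i, h (Y i ω)) / (n + 1 : ℕ))) =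
        expNeg (∑' i, f (Y i ω)) - expNeg (∑' i, (f (Y i ω) + h (Y i ω) / (n + 1 : ℕ))) := by
      intro ω
      rw [ENNReal.mul_sub (fun _ _ => expNeg_ne_top _), mul_one, ← expNeg_add, ENNReal.tsum_add]
      simp only [div_eq_mul_inv, ENNReal.tsum_mul_right]
    simp only [hsplit]
    rw [lintegral_sub, hY.laplace f hf, hY.laplace _ hg]
    · simp only [one_sub_expNeg_add]
      rw [lintegral_add_left (by fun_prop), expNeg_add,
        ENNReal.mul_sub (fun _ _ => expNeg_ne_top _), mul_one]
    · exact measurable_expNeg.comp (hY.measurable_tsum hg)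
    · rw [hY.laplace _ hg]
      exact expNeg_ne_top _
    · exact Filter.Eventually.of_forall fun ω => expNeg_antitone
        (ENNReal.tsum_le_tsum fun i => le_self_add)
  have hLHS : ∫⁻ ω, (∑' i, h (Y i ω)) * expNeg (∑' i, f (Y i ω)) ∂μ =
      ⨆ n : ℕ, ((n + 1 : ℕ) : ℝ≥0∞) * (expNeg I * (1 - expNeg (D n))) := by
    simp only [← hdiff]
    have hmul : ∀ n : ℕ, ((n + 1 : ℕ) : ℝ≥0∞) * ∫⁻ ω, expNeg (∑' i, f (Y i ω)) *
          (1 - expNeg ((∑' i, h (Y i ω)) / (n + 1 : ℕ))) ∂μ =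
        ∫⁻ ω, expNeg (∑' i, f (Y i ω)) *
          (((n + 1 : ℕ) : ℝ≥0∞) * (1 - expNeg ((∑' i, h (Y i ω)) / (n + 1 : ℕ)))) ∂μ := by
      intro n
      rw [← lintegral_const_mul _ (by fun_prop)]
      exact lintegral_congr fun ω => by ring
    simp only [hmul]
    rw [← lintegral_iSup]
    · refine lintegral_congr fun ω => ?_
      rw [← ENNReal.mul_iSup, iSup_expNeg_div_nat, mul_comm]
    · intro n
      fun_prop
    · intro m n hmn ω
      exact mul_le_mul_right (expNeg_div_nat_mono _ hmn) _
  have hmulD : ∀ n : ℕ, ((n + 1 : ℕ) : ℝ≥0∞) * D n = ∫⁻ x, expNeg (f x) *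
      (((n + 1 : ℕ) : ℝ≥0∞) * (1 - expNeg (h x / (n + 1 : ℕ)))) ∂M := by
    intro n
    rw [hD, ← lintegral_const_mul _ (by fun_prop)]
    exact lintegral_congr fun ω => by ring
  have hmono : Monotone fun (n : ℕ) x => expNeg (f x) *
      (((n + 1 : ℕ) : ℝ≥0∞) * (1 - expNeg (h x / (n + 1 : ℕ)))) := fun m n hmn x =>
    mul_le_mul_right (expNeg_div_nat_mono _ hmn) _
  have hDmono : Monotone fun n : ℕ => ((n + 1 : ℕ) : ℝ≥0∞) * D n := by
    intro m n hmn
    simp only [hmulD]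
    exact lintegral_mono (hmono hmn)
  rw [hLHS]
  simp only [mul_left_comm _ (expNeg I)]
  rw [← ENNReal.mul_iSup, iSup_mul_one_sub_expNeg hDmono, mul_comm]
  congr 1
  simp only [hmulD]
  rw [← lintegral_iSup (fun n => by fun_prop) hmono]
  refine lintegral_congr fun x => ?_
  rw [← ENNReal.mul_iSup, iSup_expNeg_div_nat, mul_comm]

lemma measurable_othersSum [Countable ι] (hY : HasPoissonLaplace Y M μ) {f : E → ℝ≥0∞} (hf : Measurable f)
    (i : ι) : Measurable (othersSum Y f i) :=
  Measurable.tsum fun _ => hY.measurable_comp hf _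

lemma measurable_othersSup [Countable ι] (hY : HasPoissonLaplace Y M μ) {f : E → ℝ≥0∞} (hf : Measurable f)
    (i : ι) : Measurable (othersSup Y f i) :=
  Measurable.iSup fun _ => hY.measurable_comp hf _

/-- The reduced Mecke formula for functionals of product form, for finite weights. -/
lemma lintegral_tsum_expNeg_others_of_ne_top [Countable ι] [IsProbabilityMeasure μ]
    (hY : HasPoissonLaplace Y M μ) {f h : E → ℝ≥0∞} (hf : Measurable f) (hh : Measurable h)
    (hfin : ∀ x, f x ≠ ∞) :
    ∫⁻ ω, ∑' i, h (Y i ω) * expNeg (othersSum Y f i ω) ∂μ =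
      (∫⁻ x, h x ∂M) * expNeg (∫⁻ x, (1 - expNeg (f x)) ∂M) := by
  have hcancel : ∀ x, h x * (expNeg (f x))⁻¹ * expNeg (f x) = h x := fun x => by
    rw [mul_assoc, ENNReal.inv_mul_cancel (expNeg_ne_zero (hfin x)) (expNeg_ne_top _), mul_one]
  -- Dividing `h` by `exp(-f)` in Campbell's formula cancels the contribution of the point itself;
  -- finiteness of `f` keeps the divisor nonzero.
  have := hY.lintegral_tsum_mul_expNeg (h := fun x => h x * (expNeg (f x))⁻¹) hf (by fun_prop)
  simp only [hcancel] at this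
  rw [← this]
  refine lintegral_congr fun ω => ?_
  rw [← ENNReal.tsum_mul_right]
  refine tsum_congr fun i => ?_
  rw [tsum_eq_add_othersSum Y f i ω, expNeg_add, ← mul_assoc, hcancel]

/-- The reduced Mecke formula for functionals of product form. -/
lemma lintegral_tsum_expNeg_others [Countable ι] [IsProbabilityMeasure μ]
    (hY : HasPoissonLaplace Y M μ) {f h : E → ℝ≥0∞} (hf : Measurable f) (hh : Measurable h)
    (hint : ∫⁻ x, h x ∂M ≠ ∞) :
    ∫⁻ ω, ∑' i, h (Y i ω) * expNeg (othersSum Y f i ω) ∂μ =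
      (∫⁻ x, h x ∂M) * expNeg (∫⁻ x, (1 - expNeg (f x)) ∂M) := by
  -- Capped weights need infinite values, hence this truncation. The exponentials decrease in `n`,
  -- so exchanging the limit with the integrals and the sum relies on `hint`.
  set g : ℕ → E → ℝ≥0∞ := fun n x => min (f x) n
  have hg : ∀ n, Measurable (g n) := fun n => by fun_prop
  have hgmono : Monotone g := fun m n hmn x => min_le_min_left _ (by exact_mod_cast hmn)
  have hgsup : ∀ x, ⨆ n, g n x = f x := fun x => by
    change ⨆ n : ℕ, f x ⊓ (n : ℝ≥0∞) = f x
    rw [← inf_iSup_eq, ENNReal.iSup_natCast, inf_top_eq]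
  have hmeas : ∀ (v : E → ℝ≥0∞), Measurable v → ∀ i,
      Measurable fun ω => h (Y i ω) * expNeg (othersSum Y v i ω) := fun v hv i =>
    (hY.measurable_comp hh i).mul (measurable_expNeg.comp (hY.measurable_othersSum hv i))
  have hn := fun n => hY.lintegral_tsum_expNeg_others_of_ne_top (hg n) hh
    fun x => ((min_le_right _ _).trans_lt (ENNReal.natCast_lt_top n)).ne
  have htsum : ∀ n, ∑' i, ∫⁻ ω, h (Y i ω) * expNeg (othersSum Y (g n) i ω) ∂μ =
      (∫⁻ x, h x ∂M) * expNeg (∫⁻ x, (1 - expNeg (g n x)) ∂M) := fun n => by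
    rw [← hn, lintegral_tsum fun i => (hmeas _ (hg n) i).aemeasurable]
  have hbound0 : ∑' i, ∫⁻ ω, h (Y i ω) ∂μ = ∫⁻ x, h x ∂M := by
    have := hY.lintegral_tsum_expNeg_others_of_ne_top (f := 0) measurable_zero hh (by simp)
    rw [← lintegral_tsum fun i => (hY.measurable_comp hh i).aemeasurable]
    simpa [othersSum] using this
  have hhfin : ∀ i, ∫⁻ ω, h (Y i ω) ∂μ ≠ ∞ := fun i => by
    refine ne_top_of_le_ne_top hint ?_
    rw [← hbound0]
    exact ENNReal.le_tsum i
  have hothers : ∀ i ω, othersSum Y f i ω = ⨆ n, othersSum Y (g n) i ω := fun i ω => by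
    simp only [othersSum]
    rw [← tsum_iSup_of_monotone (f := fun n (q : {q // q ≠ i}) => g n (Y q ω))
      fun m n hmn q => hgmono hmn _]
    simp only [hgsup]
  have hterm : ∀ i, ∫⁻ ω, h (Y i ω) * expNeg (othersSum Y f i ω) ∂μ =
      ⨅ n, ∫⁻ ω, h (Y i ω) * expNeg (othersSum Y (g n) i ω) ∂μ := by
    intro i
    rw [← lintegral_iInf_ae]
    · have : ∀ᵐ ω ∂μ, h (Y i ω) < ∞ := ae_lt_top (hY.measurable_comp hh i) (hhfin i)
      refine lintegral_congr_ae (this.mono fun ω hω => ?_)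
      dsimp only
      rw [hothers, expNeg_iSup, ENNReal.mul_iInf fun h => absurd h hω.ne]
    · exact fun n => hmeas _ (hg n) i
    · exact fun n => Filter.Eventually.of_forall fun ω => mul_le_mul_right
        (expNeg_antitone (ENNReal.tsum_le_tsum fun q => hgmono n.le_succ _)) _
    · refine ne_top_of_le_ne_top (hhfin i) (lintegral_mono fun ω => ?_)
      exact mul_le_of_le_one_right zero_le (expNeg_le_one _)
  rw [lintegral_tsum fun i => (hmeas _ hf i).aemeasurable]
  simp only [hterm]
  have hinf : ∑' i, ⨅ n, ∫⁻ ω, h (Y i ω) * expNeg (othersSum Y (g n) i ω) ∂μ =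
      ⨅ n, ∑' i, ∫⁻ ω, h (Y i ω) * expNeg (othersSum Y (g n) i ω) ∂μ := by
    let _ : MeasurableSpace ι := ⊤
    simp only [← lintegral_count]
    refine lintegral_iInf (fun n => measurable_from_top) (fun m n hmn i => ?_) ?_
    · exact lintegral_mono fun ω => mul_le_mul_right
        (expNeg_antitone (ENNReal.tsum_le_tsum fun q => hgmono hmn _)) _
    · rw [lintegral_count, htsum]
      exact ENNReal.mul_ne_top hint (expNeg_ne_top _)
  rw [hinf]
  simp only [htsum]
  rw [← ENNReal.mul_iInf fun h => absurd h hint, ← expNeg_iSup, ← lintegral_iSup]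
  · simp only [← one_sub_expNeg_iSup, hgsup]
  · exact fun n => by fun_prop
  · exact fun m n hmn x => one_sub_expNeg_mono (hgmono hmn x)

lemma measurable_capAt {F z : E → ℝ≥0∞} (hF : Measurable F) (hz : Measurable z) (t : ℝ≥0∞) :
    Measurable (capAt F z t) :=
  hF.add (measurable_const.indicator (measurableSet_lt measurable_const hz))

/-- The law of the highest level of the points, weighted by `exp (-∑ F)`. -/
def maxLaw (Y : ι → Ω → E) (μ : Measure Ω) (F z : E → ℝ≥0∞) : Measure ℝ≥0∞ :=
  (μ.withDensity fun ω => expNeg (∑' i, F (Y i ω))).map fun ω => ⨆ i, z (Y i ω)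

/-- The intensity of the pairs of a point and the highest level of the others, weighted by
`exp (-∑ F)` over the other points. -/
def pointMaxLaw (Y : ι → Ω → E) (μ : Measure Ω) (F z : E → ℝ≥0∞) : Measure (E × ℝ≥0∞) :=
  Measure.sum fun i => (μ.withDensity fun ω => expNeg (othersSum Y F i ω)).map
    fun ω => (Y i ω, othersSup Y z i ω)

lemma lintegral_maxLaw [Countable ι] (hY : HasPoissonLaplace Y M μ) {F z : E → ℝ≥0∞}
    (hF : Measurable F) (hz : Measurable z) {H : ℝ≥0∞ → ℝ≥0∞} (hH : Measurable H) :
    ∫⁻ t, H t ∂maxLaw Y μ F z = ∫⁻ ω, expNeg (∑' i, F (Y i ω)) * H (⨆ i, z (Y i ω)) ∂μ := by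
  have hm : Measurable fun ω => ⨆ i, z (Y i ω) := Measurable.iSup fun i => hY.measurable_comp hz i
  have he : Measurable fun ω => expNeg (∑' i, F (Y i ω)) :=
    measurable_expNeg.comp (hY.measurable_tsum hF)
  rw [maxLaw, lintegral_map hH hm]
  exact lintegral_withDensity_eq_lintegral_mul _ he (hH.comp hm)

/-- The distribution function of the maximum is the Laplace functional at the capped weight. -/
lemma maxLaw_Iic [Countable ι] (hY : HasPoissonLaplace Y M μ) {F z : E → ℝ≥0∞}
    (hF : Measurable F) (hz : Measurable z) (t : ℝ≥0∞) :
    maxLaw Y μ F z (Iic t) = expNeg (∫⁻ x, (1 - expNeg (capAt F z t x)) ∂M) := by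
  rw [← lintegral_indicator_one measurableSet_Iic, hY.lintegral_maxLaw hF hz
    (measurable_one.indicator measurableSet_Iic), ← hY.laplace _ (measurable_capAt hF hz t)]
  refine lintegral_congr fun ω => ?_
  rw [expNeg_tsum_capAt]
  by_cases h : ⨆ i, z (Y i ω) ∈ Iic t <;> simp [h]

lemma lintegral_pointMaxLaw [Countable ι] (hY : HasPoissonLaplace Y M μ) {F z : E → ℝ≥0∞}
    (hF : Measurable F) (hz : Measurable z) {H : E × ℝ≥0∞ → ℝ≥0∞} (hH : Measurable H) :
    ∫⁻ p, H p ∂pointMaxLaw Y μ F z =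
      ∫⁻ ω, ∑' i, expNeg (othersSum Y F i ω) * H (Y i ω, othersSup Y z i ω) ∂μ := by
  have hm : ∀ i, Measurable fun ω => (Y i ω, othersSup Y z i ω) := fun i =>
    (hY.measurable i).prodMk (hY.measurable_othersSup hz i)
  have he : ∀ i, Measurable fun ω => expNeg (othersSum Y F i ω) := fun i =>
    measurable_expNeg.comp (hY.measurable_othersSum hF i)
  have hprod : ∀ i, Measurable fun ω =>
      expNeg (othersSum Y F i ω) * H (Y i ω, othersSup Y z i ω) := fun i =>
    (he i).mul (hH.comp (hm i))
  rw [pointMaxLaw, lintegral_sum_measure, lintegral_tsum fun i => (hprod i).aemeasurable]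
  refine tsum_congr fun i => ?_
  rw [lintegral_map hH (hm i)]
  exact lintegral_withDensity_eq_lintegral_mul _ (he i) (hH.comp (hm i))

/-- A point and the highest level of the other points are independent, with the intensity of the
process and the law of the highest level of all points as marginals. -/
lemma pointMaxLaw_eq_prod [Countable ι] [IsProbabilityMeasure μ] [SigmaFinite M]
    (hY : HasPoissonLaplace Y M μ) {F z : E → ℝ≥0∞} (hF : Measurable F) (hz : Measurable z) :
    M.prod (maxLaw Y μ F z) = pointMaxLaw Y μ F z := by
  have hspan : ∀ n, spanningSets M n ∈ {B | MeasurableSet B ∧ M B < ∞} := fun n =>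
    ⟨measurableSet_spanningSets M n, measure_spanningSets_lt_top M n⟩
  -- Rectangles of a set of finite intensity and a half-line `Iic t` determine the product measure;
  -- on them the identity is the reduced Mecke formula with weight capped at `t`.
  refine Measure.prod_eq_generateFrom (C := {B | MeasurableSet B ∧ M B < ∞}) (D := range Iic)
    ?_ ?_ ?_ ?_ ⟨spanningSets M, hspan, fun n => (hspan n).2, iUnion_spanningSets M⟩
    ⟨fun _ => univ, fun _ => ⟨⊤, Iic_top⟩, fun _ => ?_, iUnion_const _⟩ ?_
  · refine le_antisymm (MeasurableSpace.generateFrom_le fun B hB => hB.1) fun B hB => ?_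
    rw [← inter_univ B, ← iUnion_spanningSets M, inter_iUnion]
    exact MeasurableSet.iUnion fun n => MeasurableSpace.measurableSet_generateFrom
      ⟨hB.inter (hspan n).1, (measure_mono inter_subset_right).trans_lt (hspan n).2⟩
  · exact (borel_eq_generateFrom_Iic ℝ≥0∞).symm.trans (BorelSpace.measurable_eq).symm
  · rintro B hB C hC -
    exact ⟨hB.1.inter hC.1, (measure_mono inter_subset_left).trans_lt hB.2⟩
  · exact isPiSystem_Iic
  · rw [← Iic_top, hY.maxLaw_Iic hF hz]
    exact (expNeg_ne_top _).lt_top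
  · rintro B ⟨hB, hBfin⟩ _ ⟨t, rfl⟩
    rw [hY.maxLaw_Iic hF hz, ← lintegral_indicator_one (hB.prod measurableSet_Iic),
      hY.lintegral_pointMaxLaw hF hz (measurable_one.indicator (hB.prod measurableSet_Iic))]
    have := hY.lintegral_tsum_expNeg_others (measurable_capAt hF hz t)
      (h := B.indicator 1) (measurable_one.indicator hB) (by
        rw [lintegral_indicator_one hB]; exact hBfin.ne)
    rw [lintegral_indicator_one hB] at this
    rw [← this]
    refine lintegral_congr fun ω => tsum_congr fun i => ?_
    rw [expNeg_othersSum_capAt]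
    by_cases h1 : Y i ω ∈ B <;> by_cases h2 : othersSup Y z i ω ∈ Iic t <;>
      simp only [mem_prod, h1, h2, indicator_of_mem, indicator_of_notMem, Pi.one_apply, and_self,
        and_true, and_false, not_false_eq_true, mul_one, one_mul, mul_zero, zero_mul]

/-- Almost surely, no point is at the highest level of the other points. -/
lemma ae_othersSup_ne [Countable ι] [IsProbabilityMeasure μ] [SigmaFinite M]
    (hY : HasPoissonLaplace Y M μ) {z : E → ℝ≥0∞} (hz : Measurable z)
    (hnull : ∀ t, M {x | z x = t} = 0) :
    ∀ᵐ ω ∂μ, ∀ i, othersSup Y z i ω ≠ z (Y i ω) := by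
  have hS : MeasurableSet {p : E × ℝ≥0∞ | z p.1 = p.2} :=
    measurableSet_eq_fun (hz.comp measurable_fst) measurable_snd
  have hfin : IsFiniteMeasure (maxLaw Y μ 0 z) := ⟨by
    rw [← Iic_top, hY.maxLaw_Iic measurable_zero hz]
    exact (expNeg_ne_top _).lt_top⟩
  -- By the product structure the level of the others can be frozen at `t`, and then the level set
  -- of `t` is `M`-null.
  have h0 : pointMaxLaw Y μ 0 z {p : E × ℝ≥0∞ | z p.1 = p.2} = 0 := by
    rw [← hY.pointMaxLaw_eq_prod measurable_zero hz, Measure.prod_apply_symm hS]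
    simp only [preimage_ofPred_eq, hnull, lintegral_zero]
  rw [← lintegral_indicator_one hS, hY.lintegral_pointMaxLaw measurable_zero hz
    (measurable_one.indicator hS), lintegral_eq_zero_iff] at h0
  · filter_upwards [h0] with ω hω i hi
    have := ENNReal.tsum_eq_zero.1 hω i
    rw [indicator_of_mem (show (Y i ω, othersSup Y z i ω) ∈ {p : E × ℝ≥0∞ | z p.1 = p.2} from
      hi.symm)] at this
    simp [othersSum] at this
  · exact Measurable.tsum fun i => (measurable_expNeg.comp
      (hY.measurable_othersSum measurable_zero i)).mul ((measurable_one.indicator hS).comp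
      ((hY.measurable i).prodMk (hY.measurable_othersSup hz i)))

/-- The Mecke formula for the points at the highest level. -/
lemma lintegral_tsum_max [Countable ι] [IsProbabilityMeasure μ] [SigmaFinite M]
    (hY : HasPoissonLaplace Y M μ) {F z h : E → ℝ≥0∞} (hF : Measurable F) (hz : Measurable z)
    (hh : Measurable h) :
    ∫⁻ ω, ∑' i, expNeg (othersSum Y F i ω) *
        (Iic (z (Y i ω))).indicator (fun _ => h (Y i ω)) (othersSup Y z i ω) ∂μ =
      ∫⁻ x, h x * expNeg (∫⁻ y, (1 - expNeg (capAt F z (z x) y)) ∂M) ∂M := by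
  have hS : MeasurableSet {p : E × ℝ≥0∞ | p.2 ≤ z p.1} :=
    measurableSet_le measurable_snd (hz.comp measurable_fst)
  have hH : Measurable ({p : E × ℝ≥0∞ | p.2 ≤ z p.1}.indicator fun p => h p.1) :=
    (hh.comp measurable_fst).indicator hS
  have hfin : IsFiniteMeasure (maxLaw Y μ F z) := ⟨by
    rw [← Iic_top, hY.maxLaw_Iic hF hz]
    exact (expNeg_ne_top _).lt_top⟩
  have := hY.lintegral_pointMaxLaw hF hz hH
  rw [← hY.pointMaxLaw_eq_prod hF hz, lintegral_prod _ hH.aemeasurable] at this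
  refine Eq.trans ?_ (this.symm.trans ?_)
  · rfl
  · refine lintegral_congr fun x => ?_
    rw [← hY.maxLaw_Iic hF hz, ← lintegral_indicator_const measurableSet_Iic]
    rfl

end HasPoissonLaplace

end Palm

/-! ### The mark space and the intensity of the marked nodes. -/

instance : Fintype Env := ⟨{.LoS, .NLoS}, by rintro (_ | _) <;> simp⟩

instance : DiscreteMeasurableSpace Env := ⟨fun _ => trivial⟩

lemma Env.sum_eq {β : Type*} [AddCommMonoid β] (f : Env → β) :
    ∑ c, f c = f .LoS + f .NLoS := by
  have : (Finset.univ : Finset Env) = {.LoS, .NLoS} := rfl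
  rw [this, Finset.sum_pair (by simp)]

/-- The layer, the horizontal position, the environment and the channel gain of a node. -/
abbrev Mark (K : ℕ) := Fin K × Plane × Env × ℝ

namespace Params

variable {K : ℕ} (par : Params K)

lemma rho_nonneg (k : Fin K) (c : Env) (x : ℝ) : 0 ≤ par.rho k c x := by
  have h : 0 ≤ par.a * Real.exp (-par.b * (Real.arcsin (par.h k / x) - par.a)) :=
    mul_nonneg par.a_nonneg (Real.exp_pos _).le
  cases c with
  | LoS => exact div_nonneg zero_le_one (by linarith)
  | NLoS => exact sub_nonneg.2 ((div_le_one (by linarith)).2 (by linarith))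

lemma sum_rho (k : Fin K) (x : ℝ) : ∑ c, ENNReal.ofReal (par.rho k c x) = 1 := by
  rw [Env.sum_eq, ← ENNReal.ofReal_add (par.rho_nonneg _ _ _) (par.rho_nonneg _ _ _)]
  simp [rho]

@[fun_prop]
lemma measurable_rho (k : Fin K) (c : Env) : Measurable (par.rho k c) := by
  cases c <;> unfold rho <;> fun_prop

@[fun_prop]
lemma measurable_linkDist (k : Fin K) : Measurable (par.linkDist k) := by
  unfold linkDist
  fun_prop

lemma measurable_linkDist_mark : Measurable fun x : Mark K => par.linkDist x.1 x.2.1 :=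
  measurable_from_prod_countable_right fun k =>
    (par.measurable_linkDist k).comp measurable_fst

instance isProbabilityMeasure_gain (c : Env) :
    IsProbabilityMeasure (gammaMeasure (par.m c) (par.m c)) :=
  isProbabilityMeasure_gammaMeasure (par.m_pos c) (par.m_pos c)

/-- The intensity of the layer-`k` nodes. -/
def layerIntensity (k : Fin K) : Measure Plane := ENNReal.ofReal (par.dens k) • volume

instance (k : Fin K) : SigmaFinite (par.layerIntensity k) := by
  have : par.layerIntensity k = (par.dens k).toNNReal • volume := rfl
  rw [this]
  infer_instance

/-- The intensity of the marked nodes. -/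
def markIntensity : Measure (Mark K) :=
  Measure.sum fun q : Fin K × Env =>
    (((par.layerIntensity q.1).withDensity fun x =>
      ENNReal.ofReal (par.rho q.1 q.2 (par.linkDist q.1 x))).prod
        (gammaMeasure (par.m q.2) (par.m q.2))).map fun y => (q.1, y.1, q.2, y.2)

lemma lintegral_markIntensity {f : Mark K → ℝ≥0∞} (hf : Measurable f) :
    ∫⁻ x, f x ∂par.markIntensity = ∑ k, ∑ c, ∫⁻ x,
      ENNReal.ofReal (par.rho k c (par.linkDist k x)) *
        ∫⁻ g, f (k, x, c, g) ∂gammaMeasure (par.m c) (par.m c) ∂par.layerIntensity k := by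
  rw [markIntensity, lintegral_sum_measure, tsum_fintype, Fintype.sum_prod_type]
  refine Finset.sum_congr rfl fun k _ => Finset.sum_congr rfl fun c _ => ?_
  have hm : Measurable fun y : Plane × ℝ => ((k, y.1, c, y.2) : Mark K) := by fun_prop
  have hfm : Measurable fun y : Plane × ℝ => f (k, y.1, c, y.2) := hf.comp hm
  have hρ : Measurable fun x => ENNReal.ofReal (par.rho k c (par.linkDist k x)) := by fun_prop
  rw [lintegral_map hf hm, lintegral_prod _ hfm.aemeasurable]
  exact lintegral_withDensity_eq_lintegral_mul _ hρ hfm.lintegral_prod_right'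

instance : SigmaFinite par.markIntensity := by
  set B : ℕ → Set (Mark K) := fun n => {x | ‖x.2.1‖ < n}
  have hB : ∀ n, MeasurableSet (B n) := fun n => measurableSet_lt (by fun_prop) measurable_const
  refine ⟨⟨⟨B, fun _ => trivial, fun n => ?_, ?_⟩⟩⟩
  · rw [← lintegral_indicator_one (hB n),
      par.lintegral_markIntensity (measurable_one.indicator (hB n))]
    refine ENNReal.sum_lt_top.2 fun k _ => ENNReal.sum_lt_top.2 fun c _ => ?_
    have hle : ∀ x : Plane, ENNReal.ofReal (par.rho k c (par.linkDist k x)) *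
        ∫⁻ g, (B n).indicator 1 (k, x, c, g) ∂gammaMeasure (par.m c) (par.m c) ≤
        (Metric.ball 0 n).indicator 1 x := by
      intro x
      have hρ : ENNReal.ofReal (par.rho k c (par.linkDist k x)) ≤ 1 := by
        rw [← par.sum_rho k (par.linkDist k x)]
        exact Finset.single_le_sum (f := fun c => ENNReal.ofReal (par.rho k c (par.linkDist k x)))
          (fun _ _ => zero_le) (Finset.mem_univ c)
      by_cases hx : ‖x‖ < n
      · have : ∀ g : ℝ, ((k, x, c, g) : Mark K) ∈ B n := fun g => hx
        simp only [this, indicator_of_mem, Pi.one_apply, lintegral_one, measure_univ, mul_one]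
        rw [indicator_of_mem (by simpa using hx)]
        exact hρ
      · have : ∀ g : ℝ, ((k, x, c, g) : Mark K) ∉ B n := fun g => hx
        simp only [this, not_false_eq_true, indicator_of_notMem, lintegral_zero, mul_zero, zero_le]
    refine (lintegral_mono hle).trans_lt ?_
    rw [lintegral_indicator_one measurableSet_ball, layerIntensity, Measure.smul_apply, smul_eq_mul]
    exact ENNReal.mul_lt_top ENNReal.ofReal_lt_top measure_ball_lt_top
  · refine eq_univ_of_forall fun x => mem_iUnion.2 ?_
    exact exists_nat_gt ‖x.2.1‖

end Params

/-- The hypothesis on the conditional probability says that `μ` restricted to `C` and the measure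
with density `r` agree on `m`, so they integrate `m`-measurable functions alike. -/
lemma lintegral_indicator_mul_of_condExp {Ω : Type*} {m mΩ : MeasurableSpace Ω} (hm : m ≤ mΩ)
    {μ : Measure Ω} [IsFiniteMeasure μ] {C : Set Ω} (hC : MeasurableSet C) {r : Ω → ℝ}
    (hr : Measurable r) (hr0 : ∀ ω, 0 ≤ r ω) (h : μ⟦C | m⟧ =ᵐ[μ] r)
    {W : Ω → ℝ≥0∞} (hW : Measurable[m] W) :
    ∫⁻ ω in C, W ω ∂μ = ∫⁻ ω, ENNReal.ofReal (r ω) * W ω ∂μ := by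
  have hint : Integrable r μ := integrable_condExp.congr h
  have heq : (μ.restrict C).trim hm = (μ.withDensity fun ω => ENNReal.ofReal (r ω)).trim hm := by
    refine @Measure.ext _ m _ _ fun A hA => ?_
    rw [trim_measurableSet_eq hm hA, trim_measurableSet_eq hm hA, withDensity_apply _ (hm A hA),
      Measure.restrict_apply (hm A hA), ← ofReal_integral_eq_lintegral_ofReal hint.integrableOn
        (Filter.Eventually.of_forall hr0), ← setIntegral_congr_ae (hm A hA) (h.mono fun _ h _ => h),
      setIntegral_condExp hm ((integrable_const _).indicator hC) hA,
      integral_indicator hC, Measure.restrict_restrict hC, inter_comm]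
    simp
  have hWm : Measurable W := hW.mono hm le_rfl
  calc ∫⁻ ω in C, W ω ∂μ = ∫⁻ ω, W ω ∂(μ.restrict C).trim hm := (lintegral_trim hm hW).symm
    _ = ∫⁻ ω, W ω ∂(μ.withDensity fun ω => ENNReal.ofReal (r ω)) := by
        rw [heq, lintegral_trim hm hW]
    _ = _ := lintegral_withDensity_eq_lintegral_mul _ hr.ennreal_ofReal hWm

/-! ### The Laplace functional of the marked nodes. -/

namespace Network

variable {K : ℕ} {par : Params K} {Ω : Type*} [MeasurableSpace Ω] {μ : Measure Ω}

/-- The mark of a node. -/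
def mark (net : Network par μ) (p : Fin K × ℕ) (ω : Ω) : Mark K :=
  (p.1, net.pos p ω, net.env p ω, net.gain (net.env p ω) p ω)

@[fun_prop]
lemma measurable_pos (net : Network par μ) (p : Fin K × ℕ) : Measurable (net.pos p) :=
  (net.poisson p.1).measurable p.2

/-- Evaluation at a random index is measurable because the environment takes only two values. -/
lemma measurable_eval_env (p : Fin K × ℕ) : Measurable
    fun y : (Env × (Fin K × ℕ) → ℝ) × ((Fin K × ℕ → Plane) × (Fin K × ℕ → Env)) =>
      y.1 (y.2.2 p, p) := by
  have : (fun y : (Env × (Fin K × ℕ) → ℝ) × ((Fin K × ℕ → Plane) × (Fin K × ℕ → Env)) =>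
      y.1 (y.2.2 p, p)) = fun y => if y.2.2 p = .LoS then y.1 (.LoS, p) else y.1 (.NLoS, p) := by
    funext y
    split_ifs with h
    · rw [h]
    · cases h' : y.2.2 p with
      | LoS => exact absurd h' h
      | NLoS => rfl
  rw [this]
  refine Measurable.ite ?_ (by fun_prop) (by fun_prop)
  exact (show Measurable fun y : (Env × (Fin K × ℕ) → ℝ) ×
    ((Fin K × ℕ → Plane) × (Fin K × ℕ → Env)) => y.2.2 p by fun_prop) (measurableSet_singleton _)

lemma measurable_allGains (net : Network par μ) :
    Measurable fun (ω : Ω) (q : Env × (Fin K × ℕ)) => net.gain q.1 q.2 ω :=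
  measurable_pi_lambda _ fun q => net.gain_measurable q.1 q.2

lemma measurable_geometry (net : Network par μ) :
    Measurable fun (ω : Ω) => ((fun p => net.pos p ω, fun p => net.env p ω) :
      (Fin K × ℕ → Plane) × (Fin K × ℕ → Env)) :=
  (measurable_pi_lambda _ fun p => net.measurable_pos p).prodMk
    (measurable_pi_lambda _ fun p => net.env_measurable p)

lemma measurable_mark (net : Network par μ) (p : Fin K × ℕ) : Measurable (net.mark p) :=
  measurable_const.prodMk ((net.measurable_pos p).prodMk ((net.env_measurable p).prodMk
    ((measurable_eval_env p).comp (net.measurable_allGains.prodMk net.measurable_geometry))))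

/-- The channel gains of finitely many nodes can be averaged independently. -/
lemma lintegral_prod_mark [IsProbabilityMeasure μ] (net : Network par μ) {φ : Mark K → ℝ≥0∞}
    (hφ : Measurable φ) (S : Finset (Fin K × ℕ)) :
    ∫⁻ ω, ∏ p ∈ S, φ (net.mark p ω) ∂μ = ∫⁻ ω, ∏ p ∈ S,
      ∫⁻ g, φ (p.1, net.pos p ω, net.env p ω, g)
        ∂gammaMeasure (par.m (net.env p ω)) (par.m (net.env p ω)) ∂μ := by
  set A : Ω → Env × (Fin K × ℕ) → ℝ := fun ω q => net.gain q.1 q.2 ω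
  set B : Ω → (Fin K × ℕ → Plane) × (Fin K × ℕ → Env) := fun ω =>
    (fun p => net.pos p ω, fun p => net.env p ω)
  have hA : Measurable A := net.measurable_allGains
  have hB : Measurable B := net.measurable_geometry
  set H : (Env × (Fin K × ℕ) → ℝ) × ((Fin K × ℕ → Plane) × (Fin K × ℕ → Env)) → ℝ≥0∞ := fun y =>
    ∏ p ∈ S, φ (p.1, y.2.1 p, y.2.2 p, y.1 (y.2.2 p, p))
  have hH : Measurable H := by
    refine Finset.measurable_prod _ fun p _ => hφ.comp ?_
    exact measurable_const.prodMk ((by fun_prop : Measurable fun y : (Env × (Fin K × ℕ) → ℝ) ×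
      ((Fin K × ℕ → Plane) × (Fin K × ℕ → Env)) => y.2.1 p).prodMk
      ((by fun_prop : Measurable fun y : (Env × (Fin K × ℕ) → ℝ) ×
      ((Fin K × ℕ → Plane) × (Fin K × ℕ → Env)) => y.2.2 p).prodMk (measurable_eval_env p)))
  have hprod := (indepFun_iff_map_prod_eq_prod_map_map hA.aemeasurable hB.aemeasurable).1
    net.gain_indep_geometry
  have hPA : IsProbabilityMeasure (μ.map A) := Measure.isProbabilityMeasure_map hA.aemeasurable
  have hPB : IsProbabilityMeasure (μ.map B) := Measure.isProbabilityMeasure_map hB.aemeasurable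
  calc ∫⁻ ω, ∏ p ∈ S, φ (net.mark p ω) ∂μ = ∫⁻ y, H y ∂μ.map fun ω => (A ω, B ω) :=
        (lintegral_map hH (hA.prodMk hB)).symm
    _ = ∫⁻ b, ∫⁻ a, H (a, b) ∂μ.map A ∂μ.map B := by
        rw [hprod, lintegral_prod_symm _ hH.aemeasurable]
    _ = ∫⁻ ω, ∫⁻ a, H (a, B ω) ∂μ.map A ∂μ := lintegral_map hH.lintegral_prod_left' hB
    _ = _ := by
        refine lintegral_congr fun ω => ?_
        have hHω : Measurable fun a => H (a, B ω) := hH.comp measurable_prodMk_right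
        rw [lintegral_map hHω hA]
        have hφ' : ∀ p : Fin K × ℕ, Measurable fun g : ℝ =>
            φ (p.1, net.pos p ω, net.env p ω, g) := fun p => hφ.comp (by fun_prop)
        -- With the geometry frozen, the gains in use have the indices `(env p, p)`, which differ
        -- for different nodes; hence they are independent.
        have hind := (net.gain_indep.precomp (g := fun p : Fin K × ℕ => (net.env p ω, p))
          fun p p' h => (Prod.ext_iff.1 h).2).comp
          (fun p g => φ (p.1, net.pos p ω, net.env p ω, g)) hφ'
        have := lintegral_prod_eq_prod_lintegral_of_indepFun S _ hind
          fun p => (hφ' p).comp (net.gain_measurable _ _)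
        refine this.trans (Finset.prod_congr rfl fun p _ => ?_)
        rw [← (net.gain_law (net.env p ω) p).map_eq, lintegral_map (hφ' p) (net.gain_measurable _ _)]
        rfl

/-- The σ-algebra generated by the positions of all nodes. -/
abbrev posAlgebra (net : Network par μ) : MeasurableSpace Ω :=
  MeasurableSpace.comap (fun (ω : Ω) (p : Fin K × ℕ) => net.pos p ω) inferInstance

/-- The environments of finitely many links can be averaged independently. -/
lemma lintegral_prod_env [IsProbabilityMeasure μ] (net : Network par μ)
    {ψ : Fin K → Plane → Env → ℝ≥0∞} (hψ : ∀ k c, Measurable fun x => ψ k x c)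
    (S : Finset (Fin K × ℕ)) :
    ∫⁻ ω, ∏ p ∈ S, ψ p.1 (net.pos p ω) (net.env p ω) ∂μ = ∫⁻ ω, ∏ p ∈ S,
      ∑ c, ENNReal.ofReal (par.rho p.1 c (par.linkDist p.1 (net.pos p ω))) *
        ψ p.1 (net.pos p ω) c ∂μ := by
  classical
  have hm : net.posAlgebra ≤ ‹MeasurableSpace Ω› :=
    (measurable_pi_lambda _ fun p => net.measurable_pos p).comap_le
  have hposm : ∀ p, Measurable[net.posAlgebra] (net.pos p) := fun p =>
    (measurable_pi_apply p).comp (comap_measurable fun (ω : Ω) (p : Fin K × ℕ) => net.pos p ω)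
  have hψpos : ∀ p : Fin K × ℕ, ∀ c, Measurable fun ω => ψ p.1 (net.pos p ω) c := fun p c =>
    (hψ p.1 c).comp (net.measurable_pos p)
  have hρpos : ∀ p : Fin K × ℕ, ∀ c,
      Measurable fun ω => par.rho p.1 c (par.linkDist p.1 (net.pos p ω)) := fun p c => by
    fun_prop
  simp only [← Finset.prod_coe_sort S]
  have hsplit : ∀ ω, ∏ p : S, ψ p.1.1 (net.pos p ω) (net.env p ω) =
      ∑ e : S → Env, {ω | (fun p : S => net.env p ω) = e}.indicator
        (fun ω => ∏ p : S, ψ p.1.1 (net.pos p ω) (e p)) ω := by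
    intro ω
    simp only [indicator_apply, mem_ofPred_eq]
    rw [Finset.sum_ite_eq]
    simp
  have hC : ∀ e : S → Env, MeasurableSet {ω | (fun p : S => net.env p ω) = e} := fun e =>
    (measurable_pi_lambda _ fun p : S => net.env_measurable p) (measurableSet_singleton e)
  simp only [hsplit]
  rw [lintegral_finsetSum _ fun e _ => (Finset.measurable_prod _ fun p _ =>
    hψpos p.1 _).indicator (hC e)]
  have hexp : ∀ ω, ∏ p : S, ∑ c, ENNReal.ofReal
        (par.rho p.1.1 c (par.linkDist p.1.1 (net.pos p ω))) * ψ p.1.1 (net.pos p ω) c =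
      ∑ e : S → Env, ∏ p : S, (ENNReal.ofReal
        (par.rho p.1.1 (e p) (par.linkDist p.1.1 (net.pos p ω))) * ψ p.1.1 (net.pos p ω) (e p)) := by
    intro ω
    rw [Finset.prod_univ_sum, Fintype.piFinset_univ]
  simp only [hexp]
  rw [lintegral_finsetSum _ fun e _ => Finset.measurable_prod _ fun p _ =>
    (hρpos p.1 _).ennreal_ofReal.mul (hψpos p.1 _)]
  refine Finset.sum_congr rfl fun e _ => ?_
  rw [lintegral_indicator (hC e)]
  -- The value outside `S` is arbitrary; `env_law` only asks for a function on all nodes.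
  set e' : Fin K × ℕ → Env := fun p => if h : p ∈ S then e ⟨p, h⟩ else .LoS
  have he' : ∀ p : S, e' p = e p := fun p => by simp [e']
  have hset : {ω | (fun p : S => net.env p ω) = e} = ⋂ p ∈ S, {ω | net.env p ω = e' p} := by
    ext ω
    simp only [mem_ofPred_eq, mem_iInter, funext_iff]
    exact ⟨fun h p hp => (h ⟨p, hp⟩).trans (he' ⟨p, hp⟩).symm,
      fun h p => (h p p.2).trans (he' p)⟩
  have hlaw := net.env_law S e'
  rw [← hset] at hlaw
  have hWm : Measurable[net.posAlgebra] fun ω => ∏ p : S, ψ p.1.1 (net.pos p ω) (e p) :=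
    Finset.measurable_prod _ fun p _ => (hψ p.1.1 (e p)).comp (hposm p.1)
  rw [lintegral_indicator_mul_of_condExp hm (hC e)
    (Finset.measurable_prod _ fun p _ => hρpos p _)
    (fun ω => Finset.prod_nonneg fun p _ => par.rho_nonneg _ _ _) hlaw hWm]
  refine lintegral_congr fun ω => ?_
  rw [Finset.prod_mul_distrib, ENNReal.ofReal_prod_of_nonneg fun p _ => par.rho_nonneg _ _ _,
    ← Finset.prod_coe_sort S]
  simp only [he']

/-- The Laplace functional of the positions of all nodes. -/
lemma lintegral_expNeg_tsum_pos [IsProbabilityMeasure μ] (net : Network par μ)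
    {v : Fin K → Plane → ℝ≥0∞} (hv : ∀ k, Measurable (v k)) :
    ∫⁻ ω, expNeg (∑' p : Fin K × ℕ, v p.1 (net.pos p ω)) ∂μ =
      expNeg (∑ k, ∫⁻ x, (1 - expNeg (v k x)) ∂par.layerIntensity k) := by
  have hg : ∀ k, Measurable fun X : ℕ → Plane => expNeg (∑' i, v k (X i)) := fun k =>
    measurable_expNeg.comp (Measurable.tsum fun i => (hv k).comp (measurable_pi_apply i))
  have hseq : ∀ k, Measurable fun (ω : Ω) (i : ℕ) => net.pos (k, i) ω := fun k =>
    measurable_pi_lambda _ fun i => net.measurable_pos (k, i)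
  have hsum : ∀ ω, expNeg (∑' p : Fin K × ℕ, v p.1 (net.pos p ω)) =
      ∏ k, expNeg (∑' i, v k (net.pos (k, i) ω)) := by
    intro ω
    rw [ENNReal.summable.tsum_prod' fun _ => ENNReal.summable, tsum_fintype, expNeg_sum]
  simp only [hsum]
  rw [expNeg_sum]
  have := lintegral_prod_eq_prod_lintegral_of_indepFun Finset.univ _
    (net.layers_indep.comp (fun k X => expNeg (∑' i, v k (X i))) hg) fun k => (hg k).comp (hseq k)
  refine this.trans (Finset.prod_congr rfl fun k _ => ?_)
  exact IsPoissonProcess.laplace_functional (Λ := par.layerIntensity k) (net.poisson k) (hv k)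

lemma tendsto_lintegral_expNeg_sum {ι : Type*} [Countable ι] [IsProbabilityMeasure μ]
    {f : ι → Ω → ℝ≥0∞} (hf : ∀ i, Measurable (f i)) :
    Filter.Tendsto (fun S : Finset ι => ∫⁻ ω, expNeg (∑ i ∈ S, f i ω) ∂μ) Filter.atTop
      (nhds (∫⁻ ω, expNeg (∑' i, f i ω) ∂μ)) := by
  refine tendsto_lintegral_filter_of_dominated_convergence (fun _ => 1) ?_ ?_ (by simp) ?_
  · exact Filter.Eventually.of_forall fun S =>
      measurable_expNeg.comp (Finset.measurable_fun_sum _ fun i _ => hf i)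
  · exact Filter.Eventually.of_forall fun S => Filter.Eventually.of_forall fun ω => expNeg_le_one _
  · exact Filter.Eventually.of_forall fun ω =>
      (continuous_expNeg.tendsto _).comp (ENNReal.summable.hasSum)

/-- The marked nodes have the Laplace functional of a Poisson process. -/
theorem hasPoissonLaplace_mark [IsProbabilityMeasure μ] (net : Network par μ) :
    HasPoissonLaplace net.mark par.markIntensity μ := by
  refine ⟨net.measurable_mark, fun f hf => ?_⟩
  set ψ : Fin K → Plane → Env → ℝ≥0∞ := fun k x c =>
    ∫⁻ g, expNeg (f (k, x, c, g)) ∂gammaMeasure (par.m c) (par.m c)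
  have hfm : ∀ k c, Measurable fun y : Plane × ℝ => f (k, y.1, c, y.2) := fun k c =>
    hf.comp (by fun_prop)
  have hψ : ∀ k c, Measurable fun x => ψ k x c := fun k c =>
    (measurable_expNeg.comp (hfm k c)).lintegral_prod_right'
  have hψ1 : ∀ k x c, ψ k x c ≤ 1 := fun k x c =>
    (lintegral_mono fun g => expNeg_le_one _).trans (by simp)
  -- The mean of `exp(-f)` over environment and gain of a layer-`k` node at `x`. As `w ≤ 1`, it
  -- equals `exp(-v)` with `v = negLog w`, which reduces the claim to a Laplace functional of the
  -- positions.
  set w : Fin K → Plane → ℝ≥0∞ := fun k x =>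
    ∑ c, ENNReal.ofReal (par.rho k c (par.linkDist k x)) * ψ k x c
  have hw : ∀ k, Measurable (w k) := fun k => Finset.measurable_fun_sum _ fun c _ => by fun_prop
  have hw1 : ∀ k x, w k x ≤ 1 := fun k x => by
    rw [← par.sum_rho k (par.linkDist k x)]
    exact Finset.sum_le_sum fun c _ => mul_le_of_le_one_right zero_le (hψ1 k x c)
  -- Gains and environments are averaged for finitely many nodes; the limit along finite sets comes
  -- afterwards.
  have hfin : ∀ S : Finset (Fin K × ℕ), ∫⁻ ω, expNeg (∑ p ∈ S, f (net.mark p ω)) ∂μ =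
      ∫⁻ ω, expNeg (∑ p ∈ S, negLog (w p.1 (net.pos p ω))) ∂μ := fun S => by
    simp only [expNeg_sum, expNeg_negLog (hw1 _ _)]
    exact (net.lintegral_prod_mark (φ := fun x => expNeg (f x)) (by fun_prop) S).trans
      (net.lintegral_prod_env hψ S)
  have hlim : ∫⁻ ω, expNeg (∑' p, f (net.mark p ω)) ∂μ =
      ∫⁻ ω, expNeg (∑' p : Fin K × ℕ, negLog (w p.1 (net.pos p ω))) ∂μ :=
    tendsto_nhds_unique (tendsto_lintegral_expNeg_sum fun p => hf.comp (net.measurable_mark p))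
      ((tendsto_lintegral_expNeg_sum fun p : Fin K × ℕ =>
        measurable_negLog.comp ((hw p.1).comp (net.measurable_pos p))).congr fun S => (hfin S).symm)
  rw [hlim, net.lintegral_expNeg_tsum_pos (v := fun k x => negLog (w k x))
    fun k => measurable_negLog.comp (hw k)]
  congr 1
  rw [par.lintegral_markIntensity (by fun_prop)]
  refine Finset.sum_congr rfl fun k _ => ?_
  have hmc : ∀ c, Measurable fun x => ∫⁻ g, (1 - expNeg (f (k, x, c, g)))
      ∂gammaMeasure (par.m c) (par.m c) := fun c =>
    (measurable_const.sub (measurable_expNeg.comp (hfm k c))).lintegral_prod_right'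
  rw [← lintegral_finsetSum _ fun c _ => by fun_prop]
  refine lintegral_congr fun x => ?_
  rw [expNeg_negLog (hw1 k x)]
  have hsub : ∀ c, ∫⁻ g, (1 - expNeg (f (k, x, c, g))) ∂gammaMeasure (par.m c) (par.m c) =
      1 - ψ k x c := fun c => by
    have hfc : Measurable fun g => expNeg (f (k, x, c, g)) :=
      measurable_expNeg.comp (hf.comp (by fun_prop))
    rw [lintegral_sub hfc
      (ne_top_of_le_ne_top ENNReal.one_ne_top (hψ1 k x c))
      (Filter.Eventually.of_forall fun g => expNeg_le_one _)]
    simp [ψ]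
  simp only [hsub]
  -- Since the probabilities `ρ` sum to one, `1 - w = ∑ ρ (1 - ψ)`.
  refine (ENNReal.eq_sub_of_add_eq (ne_top_of_le_ne_top ENNReal.one_ne_top (hw1 k x)) ?_).symm
  conv_rhs => rw [← par.sum_rho k (par.linkDist k x)]
  rw [← Finset.sum_add_distrib]
  refine Finset.sum_congr rfl fun c _ => ?_
  rw [← mul_add, tsub_add_cancel_of_le (hψ1 k x c), mul_one]

end Network

/-! ### Gamma transforms and radial integration. -/

section Integrals

/-- The Laplace transform of the gamma distribution. -/
lemma lintegral_expNeg_gammaMeasure {a r t : ℝ} (ha : 0 < a) (hr : 0 < r) (ht : 0 ≤ t) :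
    ∫⁻ g, expNeg (ENNReal.ofReal (t * g)) ∂gammaMeasure a r =
      ENNReal.ofReal ((1 / (1 + t / r)) ^ a) := by
  have hrt : 0 < r + t := by linarith
  have hm : Measurable fun g : ℝ => expNeg (ENNReal.ofReal (t * g)) := by fun_prop
  have hpdf : Measurable (gammaPDF a r) := (measurable_gammaPDFReal a r).ennreal_ofReal
  -- Exponential tilting turns the gamma density of rate `r` into a multiple of the one of rate `r +
  -- t`.
  have hpt : ∀ g : ℝ, gammaPDF a r g * expNeg (ENNReal.ofReal (t * g)) =
      ENNReal.ofReal ((1 / (1 + t / r)) ^ a) * gammaPDF a (r + t) g := by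
    intro g
    rcases lt_or_ge g 0 with hg | hg
    · rw [gammaPDF_of_neg hg, gammaPDF_of_neg hg, zero_mul, mul_zero]
    · have hΓ := Real.Gamma_pos_of_pos ha
      rw [gammaPDF_of_nonneg hg, gammaPDF_of_nonneg hg, expNeg_ofReal (mul_nonneg ht hg),
        ← ENNReal.ofReal_mul (by positivity), ← ENNReal.ofReal_mul (by positivity)]
      congr 1
      have h1 : (1 / (1 + t / r)) = r / (r + t) := by field_simp
      have h2 : Real.exp (-((r + t) * g)) = Real.exp (-(r * g)) * Real.exp (-(t * g)) := by
        rw [← Real.exp_add]; ring_nf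
      rw [h1, h2, Real.div_rpow hr.le hrt.le]
      have := (Real.rpow_pos_of_pos hrt a).ne'
      field_simp
  calc ∫⁻ g, expNeg (ENNReal.ofReal (t * g)) ∂gammaMeasure a r
      = ∫⁻ g, gammaPDF a r g * expNeg (ENNReal.ofReal (t * g)) :=
        lintegral_withDensity_eq_lintegral_mul _ hpdf hm
    _ = ENNReal.ofReal ((1 / (1 + t / r)) ^ a) := by
        simp only [hpt]
        have hpdf' : Measurable (gammaPDF a (r + t)) :=
          (measurable_gammaPDFReal a (r + t)).ennreal_ofReal
        rw [lintegral_const_mul _ hpdf', lintegral_gammaPDF_eq_one ha hrt, mul_one]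

/-- Integration of radial functions over the plane. -/
lemma lintegral_comp_norm_plane {f : ℝ → ℝ≥0∞} (hf : Measurable f) :
    ∫⁻ x : Plane, f ‖x‖ = ENNReal.ofReal (2 * Real.pi) * ∫⁻ r in Ioi 0, ENNReal.ofReal r * f r := by
  have h1 : ∫⁻ x : Plane, f ‖x‖ = ∫⁻ w : ℂ, f ‖w‖ := by
    have := (Complex.orthonormalBasisOneI.repr.symm.measurePreserving).lintegral_comp
      (f := fun w : ℂ => f ‖w‖) (by fun_prop)
    simpa only [LinearIsometryEquiv.norm_map] using this
  rw [h1, ← Complex.lintegral_comp_polarCoord_symm]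
  simp only [Complex.norm_polarCoord_symm, polarCoord_target, smul_eq_mul]
  rw [Measure.volume_eq_prod, ← Measure.prod_restrict,
    lintegral_prod _ (by fun_prop)]
  simp only [lintegral_const, Measure.restrict_apply MeasurableSet.univ, univ_inter, Real.volume_Ioo]
  rw [lintegral_mul_const _ (by fun_prop), mul_comm]
  congr 1
  · ring_nf
  · refine setLIntegral_congr_fun measurableSet_Ioi fun r hr => ?_
    rw [abs_of_pos hr]

lemma image_sqrt_sq_add {h : ℝ} (hh : 0 ≤ h) :
    (fun r : ℝ => Real.sqrt (r ^ 2 + h ^ 2)) '' Ioi 0 = Ioi h := by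
  ext d
  constructor
  · rintro ⟨r, hr, rfl⟩
    have hr' : 0 < r := hr
    exact Real.lt_sqrt_of_sq_lt (by nlinarith)
  · intro hd
    have hd' : h < d := hd
    refine ⟨Real.sqrt (d ^ 2 - h ^ 2), Real.sqrt_pos.2 (by nlinarith), ?_⟩
    dsimp only
    rw [Real.sq_sqrt (by nlinarith), sub_add_cancel, Real.sqrt_sq (by linarith)]

/-- Integration over the horizontal plane of a function of the link length. -/
lemma Params.lintegral_comp_linkDist {K : ℕ} (par : Params K) (k : Fin K) {f : ℝ → ℝ≥0∞}
    (hf : Measurable f) :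
    ∫⁻ x : Plane, f (par.linkDist k x) =
      ENNReal.ofReal (2 * Real.pi) * ∫⁻ d in Ioi (par.h k), ENNReal.ofReal d * f d := by
  set h := par.h k
  have hg : Measurable fun r : ℝ => f (Real.sqrt (r ^ 2 + h ^ 2)) := by fun_prop
  have h1 : ∫⁻ x : Plane, f (par.linkDist k x) =
      ∫⁻ x : Plane, f (Real.sqrt (‖x‖ ^ 2 + h ^ 2)) :=
    lintegral_sub_right_eq_self (fun x : Plane => f (Real.sqrt (‖x‖ ^ 2 + h ^ 2))) par.receiver
  -- Polar coordinates, then the substitution `d = √(r² + h²)`, for which `d dd = r dr`.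
  rw [h1, lintegral_comp_norm_plane hg, ← image_sqrt_sq_add (par.h_nonneg k),
    lintegral_image_eq_lintegral_abs_deriv_mul measurableSet_Ioi
      (f' := fun r => r / Real.sqrt (r ^ 2 + h ^ 2))]
  · congr 1
    refine setLIntegral_congr_fun measurableSet_Ioi fun r hr => ?_
    have hr' : 0 < r := hr
    have hs : 0 < Real.sqrt (r ^ 2 + h ^ 2) := Real.sqrt_pos.2 (by positivity)
    rw [← mul_assoc, ← ENNReal.ofReal_mul (abs_nonneg _), abs_of_pos (div_pos hr' hs),
      div_mul_cancel₀ _ hs.ne']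
  · intro r hr
    have hr' : 0 < r := hr
    have hd : HasDerivAt (fun r : ℝ => r ^ 2 + h ^ 2) (2 * r) r := by
      simpa using (hasDerivAt_pow 2 r).add_const (h ^ 2)
    have := hd.sqrt (by positivity)
    rw [mul_div_mul_left _ _ two_ne_zero] at this
    exact this.hasDerivWithinAt
  · intro r hr r' hr' heq
    have h0 : 0 < r := hr
    have h0' : 0 < r' := hr'
    have : r ^ 2 + h ^ 2 = r' ^ 2 + h ^ 2 :=
      (Real.sqrt_inj (by positivity) (by positivity)).1 heq
    exact (pow_left_inj₀ h0.le h0'.le two_ne_zero).1 (by linarith)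

end Integrals

/-! ### Power levels, the exclusion radius and the Laplace exponent. -/

namespace Params

variable {K : ℕ} (par : Params K)

lemma linkDist_nonneg (k : Fin K) (x : Plane) : 0 ≤ par.linkDist k x := Real.sqrt_nonneg _

/-- The average received power from a marked node. -/
def level (x : Mark K) : ℝ≥0∞ :=
  ENNReal.ofReal (par.P x.1 * par.linkDist x.1 x.2.1 ^ (-par.α x.2.2.1))

open Classical in
/-- The received power from a marked node if it is in layer `k` and environment `c`. -/
def rxPower (k : Fin K) (c : Env) (x : Mark K) : ℝ≥0∞ :=
  if x.2.2.1 = c ∧ x.1 = k then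
    ENNReal.ofReal (par.P k * x.2.2.2 * par.linkDist k x.2.1 ^ (-par.α c)) else 0

lemma measurable_level : Measurable par.level := by
  have hd := par.measurable_linkDist_mark
  have hP : Measurable fun x : Mark K => par.P x.1 :=
    (Measurable.of_discrete (f := par.P)).comp measurable_fst
  have hα : Measurable par.α := Measurable.of_discrete
  have hα' : Measurable fun x : Mark K => par.α x.2.2.1 := by fun_prop
  unfold level
  fun_prop

lemma measurable_rxPower (k : Fin K) (c : Env) : Measurable (par.rxPower k c) := by
  refine Measurable.ite ?_ (by fun_prop) measurable_const
  exact ((by fun_prop : Measurable fun x : Mark K => x.2.2.1) (measurableSet_singleton c)).inter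
    (measurable_fst (measurableSet_singleton k))

lemma markIntensity_eq_zero {B : Set (Mark K)} (hB : MeasurableSet B)
    (h : ∀ k c, volume {x : Plane | ∃ g, (k, x, c, g) ∈ B} = 0) : par.markIntensity B = 0 := by
  rw [← lintegral_indicator_one hB, par.lintegral_markIntensity (measurable_one.indicator hB)]
  refine Finset.sum_eq_zero fun k _ => Finset.sum_eq_zero fun c _ => ?_
  have hae : ∀ᵐ x ∂par.layerIntensity k, ∀ g, (k, x, c, g) ∉ B := by
    rw [layerIntensity, ae_iff, Measure.smul_apply]
    simp only [not_forall, not_not]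
    rw [h k c, smul_zero]
  rw [lintegral_eq_zero_of_ae_eq_zero]
  filter_upwards [hae] with x hx
  simp [hx]

lemma volume_linkDist_eq (k : Fin K) (d : ℝ) : volume {x : Plane | par.linkDist k x = d} = 0 := by
  refine measure_mono_null (t := Metric.sphere par.receiver (Real.sqrt (d ^ 2 - par.h k ^ 2)))
    (fun x hx => ?_) (Measure.addHaar_sphere _ _ _)
  have hx' : par.linkDist k x = d := hx
  have hsq : d ^ 2 = ‖x - par.receiver‖ ^ 2 + par.h k ^ 2 := by
    rw [← hx', linkDist, Real.sq_sqrt (by positivity)]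
  rw [mem_sphere_iff_norm, hsq, add_sub_cancel_right, Real.sqrt_sq (norm_nonneg _)]

lemma markIntensity_linkDist_eq_zero :
    par.markIntensity {x | par.linkDist x.1 x.2.1 = 0} = 0 := by
  refine par.markIntensity_eq_zero ?_ fun k c => ?_
  · exact par.measurable_linkDist_mark (measurableSet_singleton 0)
  · refine measure_mono_null ?_ (par.volume_linkDist_eq k 0)
    rintro x ⟨g, hx⟩
    exact hx

lemma markIntensity_level_eq (t : ℝ≥0∞) : par.markIntensity {x | par.level x = t} = 0 := by
  refine par.markIntensity_eq_zero (par.measurable_level (measurableSet_singleton t)) fun k c => ?_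
  -- In fixed layer and environment a power level determines the link length, except that `0 ^ (-α)
  -- = 0` by convention; length zero is therefore split off.
  refine measure_mono_null (t := {x | par.linkDist k x = 0} ∪
    {x | par.linkDist k x = (t.toReal / par.P k) ^ (-par.α c)⁻¹}) ?_
    (measure_union_null (par.volume_linkDist_eq k _) (par.volume_linkDist_eq k _))
  rintro x ⟨g, hx⟩
  have hx' : ENNReal.ofReal (par.P k * par.linkDist k x ^ (-par.α c)) = t := hx
  rcases (par.linkDist_nonneg k x).eq_or_lt with h0 | h0
  · exact Or.inl h0.symm
  · refine Or.inr ?_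
    have hP := par.P_pos k
    change par.linkDist k x = _
    rw [← hx', ENNReal.toReal_ofReal (by positivity), mul_div_cancel_left₀ _ hP.ne',
      ← Real.rpow_mul h0.le, mul_inv_cancel₀ (neg_ne_zero.2 (par.α_pos c).ne'), Real.rpow_one]

/-- The radial integral in the Laplace exponent of the interference. -/
def laplaceExponent (j k : Fin K) (c co : Env) (s y : ℝ) : ℝ≥0∞ :=
  ENNReal.ofReal (2 * Real.pi * par.dens k) *
    ∫⁻ x in Ioi (max (par.exclusionRadius j k c co y) (par.h k)),
      ENNReal.ofReal (x * par.rho k co x *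
        (1 - (1 / (1 + s * par.P k * x ^ (-par.α co) / par.m co)) ^ par.m co))

lemma rpow_le_iff_exclusionRadius_le (j k : Fin K) (c co : Env) {y d : ℝ} (hy : 0 < y)
    (hd : 0 < d) : par.P k * d ^ (-par.α co) ≤ par.P j * y ^ (-par.α c) ↔
      par.exclusionRadius j k c co y ≤ d := by
  have hPk := par.P_pos k
  have hPj := par.P_pos j
  have hdα : 0 < d ^ par.α co := Real.rpow_pos_of_pos hd _
  have hyα : 0 < y ^ par.α c := Real.rpow_pos_of_pos hy _
  rw [exclusionRadius, one_div, Real.rpow_inv_le_iff_of_pos (by positivity) hd.le (par.α_pos co),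
    Real.rpow_neg hd.le, Real.rpow_neg hy.le, ← div_eq_mul_inv, ← div_eq_mul_inv,
    div_le_div_iff₀ hdα hyα, div_le_iff₀ hPj, mul_comm (par.P j)]

lemma lintegral_gain_rxPower (k : Fin K) (c : Env) {s : ℝ} (hs : 0 ≤ s) (x : Plane) :
    ∫⁻ g, (1 - expNeg (ENNReal.ofReal s * par.rxPower k c (k, x, c, g)))
        ∂gammaMeasure (par.m c) (par.m c) =
      ENNReal.ofReal (1 - (1 / (1 + s * par.P k * par.linkDist k x ^ (-par.α c) / par.m c)) ^
        par.m c) := by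
  have ht : 0 ≤ s * par.P k * par.linkDist k x ^ (-par.α c) :=
    mul_nonneg (mul_nonneg hs (par.P_pos k).le) (Real.rpow_nonneg (par.linkDist_nonneg k x) _)
  have hform : ∀ g, ENNReal.ofReal s * par.rxPower k c (k, x, c, g) =
      ENNReal.ofReal (s * par.P k * par.linkDist k x ^ (-par.α c) * g) := fun g => by
    rw [rxPower, if_pos ⟨rfl, rfl⟩, ← ENNReal.ofReal_mul hs]
    ring_nf
  simp only [hform]
  rw [lintegral_sub (by fun_prop), lintegral_expNeg_gammaMeasure (par.m_pos c) (par.m_pos c) ht,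
    lintegral_one, measure_univ, ENNReal.ofReal_sub _ (Real.rpow_nonneg (by
      have := par.m_pos c
      positivity) _), ENNReal.ofReal_one]
  · rw [lintegral_expNeg_gammaMeasure (par.m_pos c) (par.m_pos c) ht]
    exact ENNReal.ofReal_ne_top
  · exact Filter.Eventually.of_forall fun _ => expNeg_le_one _

/-- The interference from the nodes that are not stronger than the associated one. -/
lemma lintegral_indicator_rxPower (j k : Fin K) (c co : Env) {s y : ℝ} (hs : 0 ≤ s) (hy : 0 < y) :
    ∫⁻ x, {x | par.level x ≤ ENNReal.ofReal (par.P j * y ^ (-par.α c))}.indicator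
        (fun x => 1 - expNeg (ENNReal.ofReal s * par.rxPower k co x)) x ∂par.markIntensity =
      par.laplaceExponent j k c co s y := by
  classical
  set t := ENNReal.ofReal (par.P j * y ^ (-par.α c))
  set R := par.exclusionRadius j k c co y
  have hmS : MeasurableSet {x : Mark K | par.level x ≤ t} :=
    measurableSet_le par.measurable_level measurable_const
  have hmF : Measurable fun x => 1 - expNeg (ENNReal.ofReal s * par.rxPower k co x) :=
    measurable_const.sub (measurable_expNeg.comp (measurable_const.mul (par.measurable_rxPower k co)))
  set L : ℝ → ℝ := fun d =>
    1 - (1 / (1 + s * par.P k * d ^ (-par.α co) / par.m co)) ^ par.m co with hL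
  set f : ℝ → ℝ≥0∞ := fun d => ENNReal.ofReal (par.rho k co d) *
    {d | ENNReal.ofReal (par.P k * d ^ (-par.α co)) ≤ t}.indicator
      (fun d => ENNReal.ofReal (L d)) d with hfdef
  have hf : Measurable f := by
    refine Measurable.mul (by fun_prop) (Measurable.indicator (by fun_prop) ?_)
    exact measurableSet_le (by fun_prop) measurable_const
  have hother : ∀ k' c', (c' = co ∧ k' = k → False) → ∀ x g, {x | par.level x ≤ t}.indicator
      (fun x => 1 - expNeg (ENNReal.ofReal s * par.rxPower k co x)) (k', x, c', g) = 0 := by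
    intro k' c' h x g
    rw [indicator_apply_eq_zero]
    intro _
    rw [rxPower, if_neg h, mul_zero, expNeg_zero, tsub_self]
  rw [par.lintegral_markIntensity (hmF.indicator hmS), Finset.sum_eq_single k, Finset.sum_eq_single co]
  · have hin : ∀ x : Plane, ENNReal.ofReal (par.rho k co (par.linkDist k x)) *
        ∫⁻ g, {x | par.level x ≤ t}.indicator
          (fun x => 1 - expNeg (ENNReal.ofReal s * par.rxPower k co x)) (k, x, co, g)
          ∂gammaMeasure (par.m co) (par.m co) = f (par.linkDist k x) := by
      intro x
      rw [hfdef]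
      congr 1
      by_cases hx : ENNReal.ofReal (par.P k * par.linkDist k x ^ (-par.α co)) ≤ t
      · have h1 : ∀ g, ((k, x, co, g) : Mark K) ∈ {x | par.level x ≤ t} := fun _ => hx
        simp only [h1, indicator_of_mem]
        rw [indicator_of_mem (show par.linkDist k x ∈ {d : ℝ |
          ENNReal.ofReal (par.P k * d ^ (-par.α co)) ≤ t} from hx)]
        exact par.lintegral_gain_rxPower k co hs x
      · have h1 : ∀ g, ((k, x, co, g) : Mark K) ∉ {x | par.level x ≤ t} := fun _ => hx
        simp only [h1, not_false_eq_true, indicator_of_notMem, lintegral_zero]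
        rw [indicator_of_notMem (show par.linkDist k x ∉ {d : ℝ |
          ENNReal.ofReal (par.P k * d ^ (-par.α co)) ≤ t} from hx)]
    simp only [hin]
    rw [layerIntensity, lintegral_smul_measure, par.lintegral_comp_linkDist k hf, smul_eq_mul,
      ← mul_assoc, ← ENNReal.ofReal_mul (par.dens_pos k).le, laplaceExponent,
      mul_comm (par.dens k)]
    congr 1
    have hpt : ∀ d ∈ Ioi (par.h k), ENNReal.ofReal d * f d = (Ici R).indicator (fun d =>
        ENNReal.ofReal (d * par.rho k co d * L d)) d := by
      intro d hd
      have hd0 : 0 < d := (par.h_nonneg k).trans_lt hd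
      have hiff : d ∈ {d | ENNReal.ofReal (par.P k * d ^ (-par.α co)) ≤ t} ↔ d ∈ Ici R := by
        change ENNReal.ofReal _ ≤ ENNReal.ofReal _ ↔ _
        rw [ENNReal.ofReal_le_ofReal_iff (mul_nonneg (par.P_pos j).le (Real.rpow_nonneg hy.le _)),
          par.rpow_le_iff_exclusionRadius_le j k c co hy hd0]
        rfl
      rw [hfdef]
      by_cases h : d ∈ Ici R
      · dsimp only
        rw [indicator_of_mem h, indicator_of_mem (hiff.2 h), ← mul_assoc,
          ← ENNReal.ofReal_mul hd0.le,
          ← ENNReal.ofReal_mul (mul_nonneg hd0.le (par.rho_nonneg _ _ _))]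
      · dsimp only
        rw [indicator_of_notMem h, indicator_of_notMem (fun h' => h (hiff.1 h')), mul_zero, mul_zero]
    rw [setLIntegral_congr_fun measurableSet_Ioi hpt, lintegral_indicator measurableSet_Ici,
      Measure.restrict_restrict measurableSet_Ici]
    -- The two domains differ at most in the endpoint `R`, a null set.
    refine setLIntegral_congr ?_
    rw [← Ioi_inter_Ioi]
    exact Ioi_ae_eq_Ici.symm.inter (Filter.EventuallyEq.refl _ _)
  · intro c' _ hc'
    simp only [hother k c' fun h => hc' h.1, lintegral_zero, mul_zero]
  · simp
  · intro k' _ hk'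
    refine Finset.sum_eq_zero fun c' _ => ?_
    simp only [hother k' c' fun h => hk' h.2, lintegral_zero, mul_zero]
  · simp

/-- Above the cap only the infinite weight counts, below it only `F`. This separates the void
probability from the interference. -/
lemma one_sub_expNeg_capAt {E : Type*} (F z : E → ℝ≥0∞) (t : ℝ≥0∞) (x : E) :
    1 - expNeg (HasPoissonLaplace.capAt F z t x) =
      (1 - expNeg (HasPoissonLaplace.capAt 0 z t x)) +
        {x | z x ≤ t}.indicator (fun x => 1 - expNeg (F x)) x := by
  by_cases h : z x ≤ t
  · simp [HasPoissonLaplace.capAt, h, not_lt.2 h]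
  · simp [HasPoissonLaplace.capAt, h, not_le.1 h]

lemma lintegral_one_sub_expNeg_capAt (j k : Fin K) (c co : Env) {s : ℝ} (hs : 0 ≤ s)
    {x : Mark K} (hj : x.1 = j) (hc : x.2.2.1 = c) (hx : 0 < par.linkDist x.1 x.2.1) :
    ∫⁻ y, (1 - expNeg (HasPoissonLaplace.capAt
        (fun y => ENNReal.ofReal s * par.rxPower k co y) par.level (par.level x) y))
        ∂par.markIntensity =
      ∫⁻ y, (1 - expNeg (HasPoissonLaplace.capAt 0 par.level (par.level x) y)) ∂par.markIntensity +
        par.laplaceExponent j k c co s (par.linkDist x.1 x.2.1) := by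
  subst hj hc
  simp only [one_sub_expNeg_capAt fun y => ENNReal.ofReal s * par.rxPower k co y]
  have hm : Measurable fun y =>
      1 - expNeg (HasPoissonLaplace.capAt 0 par.level (par.level x) y) :=
    measurable_const.sub (measurable_expNeg.comp
      (HasPoissonLaplace.measurable_capAt measurable_zero par.measurable_level _))
  rw [lintegral_add_left hm]
  congr 1
  exact par.lintegral_indicator_rxPower x.1 k x.2.2.1 co hs hx

end Params

/-! ### Measurability and almost sure description of the association. -/

lemma decode_choose {α : Type*} [Encodable α] {p : α → Prop} [DecidablePred p] (H : ∃ x, p x) :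
    ∃ n, Encodable.decode n = some (Encodable.choose H) ∧
      ∀ m < n, ∀ b : α, Encodable.decode m = some b → ¬ p b := by
  -- Quantifying over the decidability instance lets this apply to the one built inside
  -- `Encodable.chooseX`.
  have hmin : ∀ (P : ℕ → Prop) (inst : DecidablePred P) (h : ∃ n, P n),
      ∀ m < Nat.find h, ¬ P m := fun P inst h m hm => Nat.find_min h hm
  unfold Encodable.choose Encodable.chooseX
  extract_lets this
  split
  rename_i a h heq _
  refine ⟨_, heq, fun m hm b hb hpb => ?_⟩
  refine hmin _ _ _ m hm ?_
  rw [hb]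
  exact hpb

/-- `Encodable.choose` picks the first element in the order of the codes. -/
lemma choose_eq_iff {α : Type*} [Encodable α] {p : α → Prop} [DecidablePred p] (H : ∃ x, p x)
    (a : α) : Encodable.choose H = a ↔ ∃ n, Encodable.decode n = some a ∧ p a ∧
      ∀ m < n, ∀ b : α, Encodable.decode m = some b → ¬ p b := by
  obtain ⟨n, hn, hmin⟩ := decode_choose H
  constructor
  · rintro rfl
    exact ⟨n, hn, Encodable.choose_spec H, hmin⟩
  · rintro ⟨n', hn', ha, hmin'⟩
    rcases lt_trichotomy n n' with h | h | h
    · exact absurd (Encodable.choose_spec H) (hmin' n h _ hn)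
    · subst h
      exact Option.some_injective _ (hn.symm.trans hn')
    · exact absurd ha (hmin n' h _ hn')

namespace Network

variable {K : ℕ} {par : Params K} {Ω : Type*} [MeasurableSpace Ω] {μ : Measure Ω}

lemma measurable_dist (net : Network par μ) (p : Fin K × ℕ) : Measurable (net.dist p) :=
  (par.measurable_linkDist p.1).comp (net.measurable_pos p)

lemma measurable_avgPower (net : Network par μ) (p : Fin K × ℕ) : Measurable (net.avgPower p) := by
  have hα : Measurable par.α := Measurable.of_discrete
  have hd := net.measurable_dist p
  have he := net.env_measurable p
  unfold avgPower
  fun_prop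

lemma avgPower_nonneg (net : Network par μ) (p : Fin K × ℕ) (ω : Ω) : 0 ≤ net.avgPower p ω :=
  mul_nonneg (par.P_pos _).le (Real.rpow_nonneg (par.linkDist_nonneg _ _) _)

/-- Expresses the tie-breaking choice by countably many comparisons of powers, which yields
measurability. -/
lemma mainNode_eq_some_iff (net : Network par μ) (ω : Ω) (p : Fin K × ℕ) :
    net.mainNode ω = some p ↔ ∃ n, Encodable.decode n = some p ∧
      (∀ q, net.avgPower q ω ≤ net.avgPower p ω) ∧
      ∀ m < n, ∀ b : Fin K × ℕ, Encodable.decode m = some b →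
        ¬ ∀ q, net.avgPower q ω ≤ net.avgPower b ω := by
  classical
  unfold mainNode
  split_ifs with H
  · rw [Option.some_inj]
    exact choose_eq_iff H p
  · simp only [false_iff]
    rintro ⟨n, -, h, -⟩
    exact H ⟨p, h⟩

lemma mainNode_max (net : Network par μ) {ω : Ω} {p : Fin K × ℕ} (h : net.mainNode ω = some p)
    (q : Fin K × ℕ) : net.avgPower q ω ≤ net.avgPower p ω := by
  obtain ⟨n, -, hp, -⟩ := (net.mainNode_eq_some_iff ω p).1 h
  exact hp q

lemma exists_mainNode (net : Network par μ) {ω : Ω} {p : Fin K × ℕ}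
    (h : ∀ q, net.avgPower q ω ≤ net.avgPower p ω) : ∃ p', net.mainNode ω = some p' := by
  unfold mainNode
  rw [dif_pos ⟨p, h⟩]
  exact ⟨_, rfl⟩

lemma measurableSet_mainNode_eq (net : Network par μ) (p : Fin K × ℕ) :
    MeasurableSet {ω | net.mainNode ω = some p} := by
  have hmax : ∀ b : Fin K × ℕ, Measurable fun ω => ∀ q, net.avgPower q ω ≤ net.avgPower b ω :=
    fun b => Measurable.forall fun q => measurableSet_setOfPred.1
      (measurableSet_le (net.measurable_avgPower q) (net.measurable_avgPower b))
  simp only [mainNode_eq_some_iff]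
  refine measurableSet_setOfPred.2 (Measurable.exists fun n => measurable_const.and ((hmax p).and ?_))
  refine Measurable.forall fun m => measurable_const.imp ?_
  exact Measurable.forall fun b => measurable_const.imp (hmax b).not

lemma measurableSet_assocEvent (net : Network par μ) (j : Fin K) (c : Env) :
    MeasurableSet (net.assocEvent j c) :=
  measurableSet_setOfPred.2 (Measurable.exists fun i =>
    (measurableSet_setOfPred.1 (net.measurableSet_mainNode_eq (j, i))).and
      (measurableSet_setOfPred.1 (net.env_measurable (j, i) (measurableSet_singleton c))))

lemma mainDist_eq (net : Network par μ) {ω : Ω} {p : Fin K × ℕ} (h : net.mainNode ω = some p) :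
    net.mainDist ω = net.dist p ω := by
  simp [mainDist, h]

lemma measurable_mainNode (net : Network par μ) :
    @Measurable _ _ _ ⊤ net.mainNode := by
  let _ : MeasurableSpace (Option (Fin K × ℕ)) := ⊤
  refine measurable_to_countable' fun o => ?_
  cases o with
  | some p => exact net.measurableSet_mainNode_eq p
  | none =>
    have : net.mainNode ⁻¹' {none} = (⋃ p, {ω | net.mainNode ω = some p})ᶜ := by
      ext ω
      simp [Option.eq_none_iff_forall_ne_some]
    rw [this]
    exact (MeasurableSet.iUnion fun p => net.measurableSet_mainNode_eq p).compl

lemma measurable_mainDist (net : Network par μ) : Measurable net.mainDist := by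
  let _ : MeasurableSpace (Option (Fin K × ℕ)) := ⊤
  have : Measurable fun y : Option (Fin K × ℕ) × Ω =>
      (match y.1 with | some p => net.dist p y.2 | none => 0 : ℝ) := by
    refine measurable_from_prod_countable_right fun o => ?_
    cases o with
    | some p => exact net.measurable_dist p
    | none => exact measurable_const
  exact this.comp (net.measurable_mainNode.prodMk measurable_id)

lemma measurable_interference (net : Network par μ) (k : Fin K) (c : Env) :
    Measurable (net.interference k c) := by
  refine Measurable.tsum fun i => Measurable.ite ?_ ?_ measurable_const
  · exact ((net.env_measurable (k, i)) (measurableSet_singleton c)).inter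
      (net.measurableSet_mainNode_eq (k, i)).compl
  · have hd := net.measurable_dist (k, i)
    have hg := net.gain_measurable c (k, i)
    fun_prop

open HasPoissonLaplace

/-- Brings the interference into the form of a sum over the other points, to which the Mecke formula
applies. -/
lemma interference_eq (net : Network par μ) (k : Fin K) (c : Env) {ω : Ω} {p : Fin K × ℕ}
    (h : net.mainNode ω = some p) :
    net.interference k c ω = othersSum net.mark (par.rxPower k c) p ω := by
  classical
  have hsub : othersSum net.mark (par.rxPower k c) p ω =
      ∑' q, {q | q ≠ p}.indicator (fun q => par.rxPower k c (net.mark q ω)) q :=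
    tsum_subtype {q | q ≠ p} fun q => par.rxPower k c (net.mark q ω)
  rw [hsub, ENNReal.summable.tsum_prod' fun _ => ENNReal.summable, tsum_eq_single k]
  · refine tsum_congr fun i => ?_
    by_cases hp : (k, i) = p
    · simp [hp, h]
    · have hp' : ¬ p = (k, i) := fun h => hp h.symm
      rw [indicator_of_mem (show (k, i) ∈ {q | q ≠ p} from hp)]
      by_cases he : net.env (k, i) ω = c
      · simp [Params.rxPower, mark, he, hp', h, dist]
      · simp [Params.rxPower, mark, he]
  · intro k' hk'
    refine ENNReal.tsum_eq_zero.2 fun i => ?_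
    simp [Params.rxPower, mark, hk']

/-- Almost surely the associated node is the one above the level of all other nodes. -/
lemma ae_mainNode_eq_iff [IsProbabilityMeasure μ] (net : Network par μ) :
    ∀ᵐ ω ∂μ, ∀ p, net.mainNode ω = some p ↔
      othersSup net.mark par.level p ω ≤ par.level (net.mark p ω) := by
  filter_upwards [net.hasPoissonLaplace_mark.ae_othersSup_ne par.measurable_level
    par.markIntensity_level_eq] with ω hω p
  constructor
  · intro h
    exact iSup_le fun q => ENNReal.ofReal_le_ofReal (net.mainNode_max h q)
  · intro h
    -- The supremum of the others differs from the level of `p`, so the domination is strict and the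
    -- tie-breaking rule plays no role.
    have hlt : ∀ q, q ≠ p → net.avgPower q ω < net.avgPower p ω := fun q hq => by
      have h1 : par.level (net.mark q ω) < par.level (net.mark p ω) :=
        (le_iSup (fun q : {q // q ≠ p} => par.level (net.mark q ω)) ⟨q, hq⟩).trans_lt
          (lt_of_le_of_ne h (hω p))
      exact (ENNReal.ofReal_lt_ofReal_iff_of_nonneg (net.avgPower_nonneg q ω)).1 h1
    obtain ⟨p', hp'⟩ := net.exists_mainNode (ω := ω) (p := p) fun q => by
      rcases eq_or_ne q p with rfl | hq
      · exact le_rfl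
      · exact (hlt q hq).le
    rw [hp', Option.some_inj]
    by_contra hne
    exact absurd (net.mainNode_max hp' p) (not_le.2 (hlt p' hne))

end Network

/-! ### From rational to real transform parameters. -/

namespace Params

variable {K : ℕ} (par : Params K)

lemma measurable_laplaceExponent (j k : Fin K) (c co : Env) (s : ℝ) :
    Measurable (par.laplaceExponent j k c co s) := by
  set g : ℝ → ℝ≥0∞ := fun x => ENNReal.ofReal (x * par.rho k co x *
    (1 - (1 / (1 + s * par.P k * x ^ (-par.α co) / par.m co)) ^ par.m co))
  have hg : Measurable g := by fun_prop
  have hS : MeasurableSet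
      {p : ℝ × ℝ | max (par.exclusionRadius j k c co p.1) (par.h k) < p.2} := by
    refine measurableSet_lt ?_ measurable_snd
    unfold exclusionRadius
    fun_prop
  have hm : Measurable fun y => ∫⁻ x,
      {p : ℝ × ℝ | max (par.exclusionRadius j k c co p.1) (par.h k) < p.2}.indicator
        (fun p => g p.2) (y, x) :=
    ((hg.comp measurable_snd).indicator hS).lintegral_prod_right'
  refine Measurable.const_mul ?_ _
  convert hm using 2 with y
  rw [← lintegral_indicator measurableSet_Ioi]
  rfl

/-- The exponent may be infinite, so only monotone convergence is available; this is why `s` is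
approached by a monotone sequence. -/
lemma tendsto_laplaceExponent (j k : Fin K) (c co : Env) (y : ℝ) {u : ℕ → ℝ} {s : ℝ}
    (hu : Monotone u) (hu0 : ∀ n, 0 ≤ u n) (hs : 0 ≤ s)
    (hus : Filter.Tendsto u Filter.atTop (nhds s)) :
    Filter.Tendsto (fun n => par.laplaceExponent j k c co (u n) y) Filter.atTop
      (nhds (par.laplaceExponent j k c co s y)) := by
  refine ENNReal.Tendsto.const_mul ?_ (Or.inr ENNReal.ofReal_ne_top)
  have hm := par.m_pos co
  have hP := par.P_pos k
  refine lintegral_tendsto_of_tendsto_of_monotone (fun n => by fun_prop) ?_ ?_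
  · refine (ae_restrict_iff' measurableSet_Ioi).2 (Filter.Eventually.of_forall fun x hx => ?_)
    have hx0 : 0 < x := ((par.h_nonneg k).trans (le_max_right _ _)).trans_lt hx
    intro n n' hn
    refine ENNReal.ofReal_le_ofReal (mul_le_mul_of_nonneg_left ?_
      (mul_nonneg hx0.le (par.rho_nonneg _ _ _)))
    have := hu0 n
    have := hu hn
    have := hu0 n'
    refine sub_le_sub_left (Real.rpow_le_rpow (by positivity) ?_ hm.le) 1
    gcongr
  · refine (ae_restrict_iff' measurableSet_Ioi).2 (Filter.Eventually.of_forall fun x hx => ?_)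
    have hx0 : 0 < x := ((par.h_nonneg k).trans (le_max_right _ _)).trans_lt hx
    refine ENNReal.tendsto_ofReal (Filter.Tendsto.const_mul _ (Filter.Tendsto.const_sub _ ?_))
    refine Filter.Tendsto.rpow_const ?_ (Or.inr hm.le)
    refine Filter.Tendsto.div tendsto_const_nhds ?_ (by positivity)
    exact ((((hus.mul_const _).mul_const _).div_const _).const_add _)

lemma laplaceExponent_zero (j k : Fin K) (c co : Env) (y : ℝ) :
    par.laplaceExponent j k c co 0 y = 0 := by
  simp [laplaceExponent]

end Params

/-- The Laplace transform of a probability measure on `[0, ∞]` is continuous on `(0, ∞)`. -/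
lemma tendsto_laplace (ν : Measure ℝ≥0∞) [IsProbabilityMeasure ν] {u : ℕ → ℝ} {s : ℝ} (hs : 0 < s)
    (hus : Filter.Tendsto u Filter.atTop (nhds s)) :
    Filter.Tendsto (fun n => laplace ν (u n)) Filter.atTop (nhds (laplace ν s)) := by
  refine tendsto_lintegral_of_dominated_convergence (fun _ => 1) (fun n => by fun_prop)
    (fun n => Filter.Eventually.of_forall fun _ => expNeg_le_one _) (by simp)
    (Filter.Eventually.of_forall fun t => ?_)
  refine (continuous_expNeg.tendsto _).comp (ENNReal.Tendsto.mul_const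
    (ENNReal.tendsto_ofReal hus) (Or.inl ?_))
  exact (ENNReal.ofReal_pos.2 hs).ne'

lemma laplace_eq_of_forall_rat {K : ℕ} (par : Params K) (j k : Fin K) (c co : Env) (y : ℝ)
    (ν : Measure ℝ≥0∞) [IsProbabilityMeasure ν]
    (h : ∀ q : ℚ, 0 ≤ (q : ℝ) → laplace ν q = expNeg (par.laplaceExponent j k c co q y))
    {s : ℝ} (hs : 0 ≤ s) : laplace ν s = expNeg (par.laplaceExponent j k c co s y) := by
  -- The transform jumps at `s = 0` when `ν` charges `∞`, since `0 * ∞ = 0`; but `0` is itself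
  -- rational.
  rcases hs.eq_or_lt with rfl | hs'
  · simpa using h 0
  · obtain ⟨u, humono, -, hulim⟩ := Real.exists_seq_rat_strictMono_tendsto s
    set v : ℕ → ℚ := fun n => max (u n) 0
    have hv0 : ∀ n, 0 ≤ (v n : ℝ) := fun n => by exact_mod_cast le_max_right _ _
    have hvmono : Monotone fun n => (v n : ℝ) := fun m n hmn =>
      Rat.cast_le.2 (max_le_max_right 0 (humono.monotone hmn))
    have hvlim : Filter.Tendsto (fun n => (v n : ℝ)) Filter.atTop (nhds s) := by
      have := hulim.max (tendsto_const_nhds (x := (0 : ℝ)))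
      rw [max_eq_left hs] at this
      refine this.congr fun n => ?_
      simp [v]
    have h1 := tendsto_laplace ν hs' hvlim
    have h2 := (continuous_expNeg.tendsto _).comp
      (par.tendsto_laplaceExponent j k c co y hvmono hv0 hs hvlim)
    exact tendsto_nhds_unique h1 (h2.congr fun n => (h (v n) (hv0 n)).symm)

/-! ### The conditional law of the interference. -/

namespace Network

open HasPoissonLaplace

variable {K : ℕ} {par : Params K} {Ω : Type*} [MeasurableSpace Ω] {μ : Measure Ω}

/-- Joint transform of the length of the main link and of the interference on the association
event. -/
lemma lintegral_assocEvent [IsProbabilityMeasure μ] (net : Network par μ) (j k : Fin K)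
    (c co : Env) {s : ℝ} (hs : 0 ≤ s) {H : ℝ → ℝ≥0∞} (hH : Measurable H) :
    ∫⁻ ω in net.assocEvent j c,
        H (net.mainDist ω) * expNeg (ENNReal.ofReal s * net.interference k co ω) ∂μ =
      ∫⁻ x, {x : Mark K | x.1 = j ∧ x.2.2.1 = c}.indicator (fun x =>
        H (par.linkDist x.1 x.2.1) * expNeg (par.laplaceExponent j k c co s
          (par.linkDist x.1 x.2.1)) * expNeg (∫⁻ y, (1 - expNeg (capAt 0 par.level (par.level x) y))
            ∂par.markIntensity)) x ∂par.markIntensity := by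
  set S : Set (Mark K) := {x | x.1 = j ∧ x.2.2.1 = c}
  have hS : MeasurableSet S := (measurable_fst (measurableSet_singleton j)).inter
    ((by fun_prop : Measurable fun x : Mark K => x.2.2.1) (measurableSet_singleton c))
  set F : Mark K → ℝ≥0∞ := fun x => ENNReal.ofReal s * par.rxPower k co x
  have hF : Measurable F := measurable_const.mul (par.measurable_rxPower k co)
  set h : Mark K → ℝ≥0∞ := S.indicator fun x => H (par.linkDist x.1 x.2.1)
  have hh : Measurable h := (hH.comp par.measurable_linkDist_mark).indicator hS
  have hmecke := net.hasPoissonLaplace_mark.lintegral_tsum_max hF par.measurable_level hh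
  rw [← lintegral_indicator (net.measurableSet_assocEvent j c)]
  refine Eq.trans (lintegral_congr_ae ?_) (hmecke.trans (lintegral_congr_ae ?_))
  · filter_upwards [net.ae_mainNode_eq_iff] with ω hω
    by_cases hex : ∃ p, net.mainNode ω = some p
    · obtain ⟨p, hp⟩ := hex
      -- Almost surely only the associated node dominates all others, so the Mecke sum has a single
      -- nonzero term.
      rw [tsum_eq_single p]
      · rw [indicator_of_mem (mem_Iic.2 ((hω p).1 hp))]
        have hsum : othersSum net.mark F p ω = ENNReal.ofReal s * net.interference k co ω := by
          rw [net.interference_eq k co hp]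
          exact ENNReal.tsum_mul_left
        have hmem : ω ∈ net.assocEvent j c ↔ net.mark p ω ∈ S := by
          constructor
          · rintro ⟨i, hi, he⟩
            obtain rfl : p = (j, i) := Option.some_injective _ (hp.symm.trans hi)
            exact ⟨rfl, he⟩
          · rintro ⟨h1, h2⟩
            obtain ⟨p1, p2⟩ := p
            obtain rfl : p1 = j := h1
            exact ⟨p2, hp, h2⟩
        by_cases hA : ω ∈ net.assocEvent j c
        · have h1 : h (net.mark p ω) = H (net.dist p ω) := indicator_of_mem (hmem.1 hA) _
          rw [indicator_of_mem hA, hsum, net.mainDist_eq hp, mul_comm, h1]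
        · have hn : net.mark p ω ∉ S := fun h' => hA (hmem.2 h')
          have h0 : h (net.mark p ω) = 0 := indicator_of_notMem hn _
          rw [indicator_of_notMem hA, h0, mul_zero]
      · intro q hq
        rw [indicator_of_notMem, mul_zero]
        intro hmem
        exact hq (Option.some_injective _ (((hω q).2 hmem).symm.trans hp))
    · rw [indicator_of_notMem]
      · refine (ENNReal.tsum_eq_zero.2 fun q => ?_).symm
        rw [indicator_of_notMem, mul_zero]
        intro hmem
        exact hex ⟨q, (hω q).2 hmem⟩
      · rintro ⟨i, hi, -⟩
        exact hex ⟨_, hi⟩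
  · have hpos : ∀ᵐ x ∂par.markIntensity, par.linkDist x.1 x.2.1 ≠ 0 := by
      rw [ae_iff]
      simpa using par.markIntensity_linkDist_eq_zero
    filter_upwards [hpos] with x hx
    by_cases hxS : x ∈ S
    · have hx0 : 0 < par.linkDist x.1 x.2.1 := lt_of_le_of_ne (par.linkDist_nonneg _ _) hx.symm
      have hhx : h x = H (par.linkDist x.1 x.2.1) := indicator_of_mem hxS _
      rw [hhx, indicator_of_mem hxS, par.lintegral_one_sub_expNeg_capAt j k c co hs hxS.1 hxS.2 hx0,
        expNeg_add, mul_assoc, mul_comm (expNeg (par.laplaceExponent _ _ _ _ _ _))]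
    · have hhx : h x = 0 := indicator_of_notMem hxS _
      rw [hhx, zero_mul, indicator_of_notMem hxS]

lemma setLIntegral_laplace_condDistrib [IsProbabilityMeasure μ] (net : Network par μ)
    (j k : Fin K) (c co : Env) {s : ℝ} (hs : 0 ≤ s) {B : Set ℝ} (hB : MeasurableSet B) :
    ∫⁻ y in B, laplace (condDistrib (net.interference k co) net.mainDist
        (μ[|net.assocEvent j c]) y) s ∂(μ[|net.assocEvent j c]).map net.mainDist =
      ∫⁻ y in B, expNeg (par.laplaceExponent j k c co s y)
        ∂(μ[|net.assocEvent j c]).map net.mainDist := by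
  set A := net.assocEvent j c
  have hD := net.measurable_mainDist
  have hI := net.measurable_interference k co
  have hΨ : Measurable fun y => expNeg (par.laplaceExponent j k c co s y) :=
    measurable_expNeg.comp (par.measurable_laplaceExponent j k c co s)
  have hf : Measurable fun p : ℝ × ℝ≥0∞ =>
      B.indicator 1 p.1 * expNeg (ENNReal.ofReal s * p.2) :=
    ((measurable_one.indicator hB).comp measurable_fst).mul (by fun_prop)
  have hleft : ∫⁻ y in B, laplace (condDistrib (net.interference k co) net.mainDist μ[|A] y) s
      ∂(μ[|A]).map net.mainDist = ∫⁻ ω, B.indicator 1 (net.mainDist ω) *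
        expNeg (ENNReal.ofReal s * net.interference k co ω) ∂μ[|A] := by
    rw [← lintegral_map hf (hD.prodMk hI), ← compProd_map_condDistrib hI.aemeasurable,
      Measure.lintegral_compProd hf, ← lintegral_indicator hB]
    refine lintegral_congr fun y => ?_
    by_cases hy : y ∈ B <;> simp [hy, laplace]
  -- The factor with parameter `0` equals one; it lets `lintegral_assocEvent` evaluate this side
  -- too, at `s = 0`. Both sides then carry the same void probability and agree pointwise in the
  -- mark.
  have hright : ∫⁻ y in B, expNeg (par.laplaceExponent j k c co s y) ∂(μ[|A]).map net.mainDist =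
      ∫⁻ ω, B.indicator (fun y => expNeg (par.laplaceExponent j k c co s y)) (net.mainDist ω) *
        expNeg (ENNReal.ofReal 0 * net.interference k co ω) ∂μ[|A] := by
    rw [← lintegral_indicator hB, lintegral_map (hΨ.indicator hB) hD]
    simp
  rw [hleft, hright, ProbabilityTheory.cond, lintegral_smul_measure, lintegral_smul_measure,
    net.lintegral_assocEvent j k c co hs (measurable_one.indicator hB),
    net.lintegral_assocEvent j k c co le_rfl (hΨ.indicator hB)]
  congr 1
  refine lintegral_congr fun x => ?_
  by_cases hx : x ∈ {x : Mark K | x.1 = j ∧ x.2.2.1 = c}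
  · rw [indicator_of_mem hx, indicator_of_mem hx, par.laplaceExponent_zero, expNeg_zero, mul_one]
    by_cases hxB : par.linkDist x.1 x.2.1 ∈ B <;> simp [hxB]
  · rw [indicator_of_notMem hx, indicator_of_notMem hx]

lemma ae_laplace_condDistrib [IsProbabilityMeasure μ] (net : Network par μ)
    (j k : Fin K) (c co : Env) {s : ℝ} (hs : 0 ≤ s) :
    ∀ᵐ y ∂(μ[|net.assocEvent j c]).map net.mainDist,
      laplace (condDistrib (net.interference k co) net.mainDist (μ[|net.assocEvent j c]) y) s =
        expNeg (par.laplaceExponent j k c co s y) :=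
  ae_eq_of_forall_setLIntegral_eq_of_sigmaFinite
    (Measurable.lintegral_kernel (f := fun t => expNeg (ENNReal.ofReal s * t)) (by fun_prop))
    (measurable_expNeg.comp (par.measurable_laplaceExponent j k c co s))
    fun _ hB _ => net.setLIntegral_laplace_condDistrib j k c co hs hB

end Network

end AerialNetwork

end

theorem lemma2 {K : ℕ} (par : AerialNetwork.Params K) {Ω : Type*} [MeasurableSpace Ω]
    (μ : Measure Ω) [IsProbabilityMeasure μ] (net : AerialNetwork.Network par μ)
    (j k : Fin K) (c co : AerialNetwork.Env) :
    MeasurableSet (net.assocEvent j c) ∧ Measurable net.mainDist ∧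
    Measurable (net.interference k co) ∧
    ∀ᵐ y ∂((μ[|net.assocEvent j c]).map net.mainDist), ∀ s : ℝ, 0 ≤ s →
      AerialNetwork.laplace
          (condDistrib (net.interference k co) net.mainDist (μ[|net.assocEvent j c]) y) s =
        AerialNetwork.expNeg (ENNReal.ofReal (2 * Real.pi * par.dens k) *
          ∫⁻ x in Ioi (max (par.exclusionRadius j k c co y) (par.h k)),
            ENNReal.ofReal (x * par.rho k co x *
              (1 - (1 / (1 + s * par.P k * x ^ (-par.α co) / par.m co)) ^ par.m co))) := by
  refine ⟨net.measurableSet_assocEvent j c, net.measurable_mainDist,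
    net.measurable_interference k co, ?_⟩
  -- The exceptional set depends on the parameter; countably many parameters share one.
  have hrat : ∀ᵐ y ∂((μ[|net.assocEvent j c]).map net.mainDist), ∀ q : ℚ, 0 ≤ (q : ℝ) →
      AerialNetwork.laplace
          (condDistrib (net.interference k co) net.mainDist (μ[|net.assocEvent j c]) y) q =
        AerialNetwork.expNeg (par.laplaceExponent j k c co q y) :=
    ae_all_iff.2 fun q => by
      by_cases hq : 0 ≤ (q : ℝ)
      · exact (net.ae_laplace_condDistrib j k c co hq).mono fun y hy _ => hy
      · exact Filter.Eventually.of_forall fun y h => absurd h hq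
  exact hrat.mono fun y hy s hs => AerialNetwork.laplace_eq_of_forall_rat par j k c co y _ hy hs
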